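/- Let $\mathcal X$ be a measurable space carrying an arbitrary total order, let $\mathcal H$ be a real Hilbert space and let $\varphi:\mathcal X\to\mathcal H$ be a feature map whose kernel $(x,x')\mapsto\langle\varphi(x),\varphi(x')\rangle$ is measurable on $\mathcal X\times\mathcal X$. Let $\rho>0$. All multisets are finite, $\cup$ adds multiplicities, and $|\cdot|$ counts elements with multiplicity. **Support vector machine.** For a multiset $S$ of examples $(x_1,y_1),\dots,(x_n,y_n)\in\mathcal X\times\{-1,1\}$, $n\ge 0$, let $(w^*(S),b^*(S))$ be the $(w,b)$-component of the minimizer of $$\min_{w\in\mathcal H,\ b\in\mathbb R,\ \xi_1,\dots,\xi_n\ge 0}\ \|w\|^2+\rho\sum_{i=1}^n\xi_i\quad\text{subject to}\quad 1-y_i\big(\langle w,\varphi(x_i)\rangle+b\big)\le\xi_i,\ i=1,\dots,n,$$ where, if $b$ is not unique, the minimizer with the smallest $|b|$ is selected. The classifier $\mathcal A_{\mathrm{SVM}}(S):\mathcal X\to\{-1,1\}$ assigns to $x$ the label $1$ if $\langle w^*(S),\varphi(x)\rangle+b^*(S)\ge 0$ and the label $-1$ otherwise. **Compression.** Let $\mathsf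 c_{\mathrm{SVM}}(S)=S_+\cup S_0$, where $S_+$ is the sub-multiset of all the examples of $S$, with their multiplicities, for which $1-y(\langle w^*(S),\varphi(x)\rangle+b^*(S))>0$, and $S_0$ is chosen as follows. Consider the sub-multisets $T$ of $S$ such that (a) $1-y(\langle w^*(S),\varphi(x)\rangle+b^*(S))=0$ for all $(x,y)\in T$, and (b) $(w^*(S_+\cup T),b^*(S_+\cup T))=(w^*(S),b^*(S))$. Among those of smallest cardinality, $S_0$ is the one whose list of instances $x$, sorted in increasing order, is lexicographically smallest. **The bound.** For $\delta\in(0,1)$ and $N\ge 1$ let, for $k=0,\dots,N-1$, $\epsilon_k$ be the unique solution $\alpha\in(0,1)$ of $$\frac{\delta}{N}\sum_{m=k}^{N-1}\frac{\binom mk}{\binom Nk}(1-\alpha)^{-(N-m)}=1,$$ and let $\epsilon_N=1$. **Theorem.** Let $(\boldsymbol x_1,\boldsymbol y_1),\dots,(\boldsymbol x_N,\boldsymbol y_N)$ be independent random examples in $\mathcal X\times\{-1,1\}$ with the same distribution $D$, let $\boldsymbol S$ be the multiset that they form, and, for a classifier $h$, let $\mathsf R(h)=D\{(x,y): h(x)\ne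 y\}$. Then, for any $\delta\in(0,1)$, $$\Pr\Big\{\mathsf R\big(\mathcal A_{\mathrm{SVM}}(\boldsymbol S)\big)>\epsilon_{\boldsymbol k}\Big\}\le\delta,\qquad \boldsymbol k=|\mathsf c_{\mathrm{SVM}}(\boldsymbol S)|.$$ -/

import Mathlib

open MeasureTheory ProbabilityTheory

noncomputable section

namespace SVMRisk

/-! ### The bound `ε_k` -/

/-- `Ψ_{k,δ}(α) = (δ/N) ∑_{m=k}^{N-1} (m choose k) / (N choose k) * (1-α)^{-(N-m)}`.
In the range of summation `m < N`, so that `N - m` is the true difference. -/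
def Psi (N : ℕ) (δ : ℝ) (k : ℕ) (α : ℝ) : ℝ :=
  δ / N * ∑ m ∈ Finset.Ico k N, (m.choose k : ℝ) / (N.choose k : ℝ) * ((1 - α) ^ (N - m))⁻¹

/-- `α` is a solution in `(0,1)` of the equation `Ψ_{k,δ}(α) = 1`. -/
def IsPsiRoot (N : ℕ) (δ : ℝ) (k : ℕ) (α : ℝ) : Prop :=
  α ∈ Set.Ioo (0 : ℝ) 1 ∧ Psi N δ k α = 1

/-- `ε_k` is the solution in `(0,1)` of `Ψ_{k,δ}(α) = 1` for `k = 0, …, N-1`, and `ε_N = 1`. -/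
def epsilonK (N : ℕ) (δ : ℝ) (k : ℕ) : ℝ :=
  if k < N then Classical.epsilon (IsPsiRoot N δ k) else 1

/-- For `k < N` and `δ ∈ (0,1)` the equation has exactly one solution in `(0,1)`. -/
theorem existsUnique_isPsiRoot (N : ℕ) (δ : ℝ) (k : ℕ) (hk : k < N) (h0 : 0 < δ) (h1 : δ < 1) :
    ∃! α, IsPsiRoot N δ k α := by
  have hN : (0 : ℝ) < N := by exact_mod_cast (by omega : 0 < N)
  have hN1 : (1 : ℝ) ≤ N := by exact_mod_cast (by omega : 1 ≤ N)
  have hNk : (0 : ℝ) < (N.choose k : ℝ) := by exact_mod_cast Nat.choose_pos hk.le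
  have hc : ∀ m ∈ Finset.Ico k N, 0 < (m.choose k : ℝ) / (N.choose k : ℝ) := fun m hm =>
    div_pos (by exact_mod_cast Nat.choose_pos (Finset.mem_Ico.1 hm).1) hNk
  have hc1 : ∀ m ∈ Finset.Ico k N, (m.choose k : ℝ) / (N.choose k : ℝ) ≤ 1 := fun m hm => by
    rw [div_le_one hNk]
    exact_mod_cast Nat.choose_le_choose k (Finset.mem_Ico.1 hm).2.le
  have hlast : N - 1 ∈ Finset.Ico k N := Finset.mem_Ico.2 ⟨by omega, by omega⟩
  have hmono : ∀ a b : ℝ, a < b → b < 1 → Psi N δ k a < Psi N δ k b := by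
    intro a b hab hb
    unfold Psi
    refine mul_lt_mul_of_pos_left ?_ (by positivity)
    refine Finset.sum_lt_sum_of_nonempty ⟨N - 1, hlast⟩ fun m hm => ?_
    refine mul_lt_mul_of_pos_left ?_ (hc m hm)
    have h1b : 0 < 1 - b := by linarith
    have hne : N - m ≠ 0 := by have := (Finset.mem_Ico.1 hm).2; omega
    gcongr
  have hcont : ContinuousOn (Psi N δ k) (Set.Iio 1) := by
    unfold Psi
    refine continuousOn_const.mul (continuousOn_finsetSum _ fun m _ => continuousOn_const.mul ?_)
    refine ContinuousOn.inv₀ (by fun_prop) fun x hx => ?_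
    have : 0 < 1 - x := by simpa using hx
    positivity
  have hzero : Psi N δ k 0 < 1 := by
    have : ∑ m ∈ Finset.Ico k N, (m.choose k : ℝ) / (N.choose k : ℝ) * ((1 - (0 : ℝ)) ^ (N - m))⁻¹
        ≤ N := by
      calc _ ≤ ∑ m ∈ Finset.Ico k N, (1 : ℝ) :=
            Finset.sum_le_sum fun m hm => by simpa using hc1 m hm
        _ = ((N - k : ℕ) : ℝ) := by simp
        _ ≤ N := by exact_mod_cast Nat.sub_le N k
    unfold Psi
    calc _ ≤ δ / N * N := mul_le_mul_of_nonneg_left this (by positivity)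
      _ = δ := by field_simp
      _ < 1 := h1
  set c : ℝ := ((N - 1).choose k : ℝ) / (N.choose k : ℝ) with hcdef
  have hcpos : 0 < c := hc _ hlast
  have hcle : c ≤ 1 := hc1 _ hlast
  set t : ℝ := δ * c / (2 * N) with ht
  have htpos : 0 < t := by positivity
  have htlt : t < 1 := by
    rw [ht, div_lt_one (by positivity)]
    nlinarith
  have hbig : 1 < Psi N δ k (1 - t) := by
    have h2 : c * t⁻¹ ≤ ∑ m ∈ Finset.Ico k N,
        (m.choose k : ℝ) / (N.choose k : ℝ) * ((1 - (1 - t)) ^ (N - m))⁻¹ := by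
      have h3 := Finset.single_le_sum (f := fun m : ℕ =>
        (m.choose k : ℝ) / (N.choose k : ℝ) * ((1 - (1 - t)) ^ (N - m))⁻¹)
        (fun m hm => by
          have := (hc m hm).le
          have h4 : 1 - (1 - t) = t := by ring
          simp only [h4]
          positivity) hlast
      have h5 : N - (N - 1) = 1 := by omega
      simpa [h5] using h3
    unfold Psi
    calc (1 : ℝ) < 2 := one_lt_two
      _ = δ / N * (c * t⁻¹) := by rw [ht]; field_simp
      _ ≤ _ := mul_le_mul_of_nonneg_left h2 (by positivity)
  obtain ⟨α, hα, hα1⟩ := intermediate_value_Ioo (by linarith : (0 : ℝ) ≤ 1 - t)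
    (hcont.mono fun x hx => by
      have := hx.2
      simp only [Set.mem_Iio]
      linarith) ⟨hzero, hbig⟩
  refine ⟨α, ⟨⟨hα.1, by linarith [hα.2]⟩, hα1⟩, fun β hβ => ?_⟩
  rcases lt_trichotomy β α with h | h | h
  · have := hmono β α h (by linarith [hα.2])
    rw [hα1, hβ.2] at this
    exact absurd this (lt_irrefl _)
  · exact h
  · have := hmono α β h hβ.1.2
    rw [hα1, hβ.2] at this
    exact absurd this (lt_irrefl _)

/-! ### Soft-margin support vector machines -/

/-- The set of labels `{-1, 1}`. -/
abbrev Label : Type := {y : ℝ // y = -1 ∨ y = 1}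

variable {X : Type*} {H : Type*} [NormedAddCommGroup H] [InnerProductSpace ℝ H]

/-- The affine function `⟨w, φ(x)⟩ + b` of an instance, for `p = (w, b)`. -/
def decisionValue (φ : X → H) (p : H × ℝ) (x : X) : ℝ := inner ℝ p.1 (φ x) + p.2

/-- The quantity `1 - y (⟨w, φ(x)⟩ + b)` for `p = (w, b)` and `z = (x, y)`. -/
def marginGap (φ : X → H) (p : H × ℝ) (z : X × Label) : ℝ :=
  1 - (z.2 : ℝ) * decisionValue φ p z.1

open Classical in
/-- Feasibility of `(w, b)`, `ξ` for the program of the multiset `S`. The index `i` runs through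
the elements of `S`, each as many times as is its multiplicity, and `i.1` is the example. -/
def Feasible (φ : X → H) (S : Multiset (X × Label)) (p : H × ℝ) (ξ : S.ToType → ℝ) : Prop :=
  ∀ i : S.ToType, 0 ≤ ξ i ∧ marginGap φ p i.1 ≤ ξ i

open Classical in
/-- The objective `‖w‖² + ρ ∑ ξ_i`. -/
def objective (ρ : ℝ) (S : Multiset (X × Label)) (p : H × ℝ) (ξ : S.ToType → ℝ) : ℝ :=
  ‖p.1‖ ^ 2 + ρ * ∑ i : S.ToType, ξ i

open Classical in
/-- `(w, b)`, `ξ` is a minimizer of the program of `S`. -/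
def IsMinimizer (φ : X → H) (ρ : ℝ) (S : Multiset (X × Label)) (p : H × ℝ)
    (ξ : S.ToType → ℝ) : Prop :=
  Feasible φ S p ξ ∧
    ∀ (p' : H × ℝ) (ξ' : S.ToType → ℝ), Feasible φ S p' ξ' →
      objective ρ S p ξ ≤ objective ρ S p' ξ'

/-- `(w, b)` is optimal for the program of `S`, together with some values of the variables `ξ`. -/
def IsOptimal (φ : X → H) (ρ : ℝ) (S : Multiset (X × Label)) (p : H × ℝ) : Prop :=
  ∃ ξ, IsMinimizer φ ρ S p ξ

/-- `(w, b)` is optimal, and `|b|` is the smallest possible among the optimal pairs. -/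
def IsSolution (φ : X → H) (ρ : ℝ) (S : Multiset (X × Label)) (p : H × ℝ) : Prop :=
  IsOptimal φ ρ S p ∧ ∀ p' : H × ℝ, IsOptimal φ ρ S p' → |p.2| ≤ |p'.2|

/-- The pair `(w*(S), b*(S))`. -/
def solution (φ : X → H) (ρ : ℝ) (S : Multiset (X × Label)) : H × ℝ :=
  Classical.epsilon (IsSolution φ ρ S)

open Classical in
/-- The classifier `A_SVM(S)`. -/
def svm (φ : X → H) (ρ : ℝ) (S : Multiset (X × Label)) (x : X) : Label :=
  if 0 ≤ decisionValue φ (solution φ ρ S) x then ⟨1, Or.inr rfl⟩ else ⟨-1, Or.inl rfl⟩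

/-! ### The compression function of the SVM -/

open Classical in
/-- `S₊`: all the examples of `S`, with their multiplicity, for which
`1 - y (⟨w*(S), φ(x)⟩ + b*(S)) > 0`. -/
def violating (φ : X → H) (ρ : ℝ) (S : Multiset (X × Label)) : Multiset (X × Label) :=
  S.filter (fun z => 0 < marginGap φ (solution φ ρ S) z)

/-- `T` is a sub-multiset of `S` made of examples on the margin such that `S₊ ∪ T` has the same
solution as `S`. (The union adds up multiplicities.) -/
def IsSupport (φ : X → H) (ρ : ℝ) (S T : Multiset (X × Label)) : Prop :=
  T ≤ S ∧ (∀ z ∈ T, marginGap φ (solution φ ρ S) z = 0) ∧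
    solution φ ρ (violating φ ρ S + T) = solution φ ρ S

/-- `T` has smallest cardinality among the multisets satisfying `IsSupport`. -/
def IsMinSupport (φ : X → H) (ρ : ℝ) (S T : Multiset (X × Label)) : Prop :=
  IsSupport φ ρ S T ∧ ∀ T', IsSupport φ ρ S T' → T.card ≤ T'.card

/-- The instances that occur in `T`, in increasing order, with repetitions. -/
def sortedInstances [LinearOrder X] (T : Multiset (X × Label)) : List X :=
  (T.map Prod.fst).sort (· ≤ ·)

/-- `T` is the selected one among the multisets satisfying `IsMinSupport`: its smallest instance is
the smallest, then its second smallest instance, and so on (lexicographic order of lists). -/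
def IsSelectedSupport [LinearOrder X] (φ : X → H) (ρ : ℝ) (S T : Multiset (X × Label)) : Prop :=
  IsMinSupport φ ρ S T ∧
    ∀ T', IsMinSupport φ ρ S T' → sortedInstances T ≤ sortedInstances T'

/-- `S₀`. -/
def selectedSupport [LinearOrder X] (φ : X → H) (ρ : ℝ) (S : Multiset (X × Label)) :
    Multiset (X × Label) :=
  Classical.epsilon (IsSelectedSupport φ ρ S)

/-- The compression `c_SVM(S) = S₊ ∪ S₀`. -/
def compression [LinearOrder X] (φ : X → H) (ρ : ℝ) (S : Multiset (X × Label)) :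
    Multiset (X × Label) :=
  violating φ ρ S + selectedSupport φ ρ S

/-! ### Training set and risk -/

/-- The multiset `ms(z_1, …, z_N)` of a list of examples. -/
def trainingSet {N : ℕ} (z : Fin N → X × Label) : Multiset (X × Label) :=
  Finset.univ.val.map z

/-- The probability of misclassification `D {(x, y) | h(x) ≠ y}` of the classifier `h`, where `D` is
the distribution of an example. -/
def risk [MeasurableSpace X] (D : Measure (X × Label)) (h : X → Label) : ℝ :=
  D.real {z | h z.1 ≠ z.2}

end SVMRisk

end

/-! The argument separates a general risk bound for compression schemes from the convex analysis
showing that the support vector machine is such a scheme. Everything is phrased with sets of indices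
instead of multisets of examples, and no compression set is selected: all sets of smallest
cardinality are kept. They have the cardinality of the compression and yield the same classifier, so
the tie-break by the order on instances, which need not be measurable, never enters.

Convexity. The cost is strongly convex in `w`, so `w*` is unique, and the smallest `|b|` makes the
pair unique. Adding examples with nonpositive gap keeps the solution (`solution_add_eq`), as does
removing examples with negative gap (`solution_eq_of_neg`). Hence, if `I` compresses the whole
sample and `I ⊆ J`, then `I` compresses the subsample `J`, every set that compresses `J` also
compresses the whole sample, and all examples outside `I` are classified correctly.

Probability. Let `q_I` be the accuracy of the classifier built from `I`, and split a unit mass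
equally among the sets compressing `J`. By the stability just described, for `I ⊆ J` the weight of
`I` in the full sample is at most its weight in `J` times the indicator that all examples outside
`J` are classified correctly by `I` (`weight_univ_le`). Those examples are independent of the weight
in `J` and of `q_I`, so for `|J| = m` the mean of (full weight of `I`) times `q_I^{-(N-m)}` is at
most the mean weight of `I` in `J` (`lintegral_weight_mul_inv_le`).

On the bad event, monotonicity of `Psi` gives `1 ≤ Psi(1 - q_I)` for every compressing `I` (with
value infinity when `q_I = 0`). The coefficient `(m choose k)/(N choose k)` equals `(N-k choose
m-k)/(N choose m)`, the fraction of the `m`-subsets `J` that contain a given `I` of size `k`. So the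
probability is at most the sum over `m < N` of `δ/N` times an average over `J` of total mean
weights, each of which is 1; this gives `δ` (`measure_epsilonK_lt_le`). -/

noncomputable section

namespace SVMRisk

/-! ### The program without slack variables -/

section Program

variable {X : Type*} {H : Type*} [NormedAddCommGroup H] [InnerProductSpace ℝ H]

/-- The hinge loss of `p = (w, b)` at the example `z`. -/
def hinge (φ : X → H) (p : H × ℝ) (z : X × Label) : ℝ := max 0 (marginGap φ p z)

/-- The total hinge loss on a multiset of examples. -/
def loss (φ : X → H) (S : Multiset (X × Label)) (p : H × ℝ) : ℝ := (S.map (hinge φ p)).sum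

/-- The objective of the program once the slack variables are optimized away. -/
def cost (φ : X → H) (ρ : ℝ) (S : Multiset (X × Label)) (p : H × ℝ) : ℝ :=
  ‖p.1‖ ^ 2 + ρ * loss φ S p

theorem hinge_nonneg (φ : X → H) (p : H × ℝ) (z : X × Label) : 0 ≤ hinge φ p z := le_max_left _ _

theorem loss_nonneg (φ : X → H) (S : Multiset (X × Label)) (p : H × ℝ) : 0 ≤ loss φ S p :=
  Multiset.sum_nonneg fun _ hx => by
    obtain ⟨z, -, rfl⟩ := Multiset.mem_map.1 hx
    exact hinge_nonneg φ p z

theorem loss_add (φ : X → H) (S T : Multiset (X × Label)) (p : H × ℝ) :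
    loss φ (S + T) p = loss φ S p + loss φ T p := by
  simp [loss]

theorem loss_eq_zero {φ : X → H} {S : Multiset (X × Label)} {p : H × ℝ}
    (h : ∀ z ∈ S, marginGap φ p z ≤ 0) : loss φ S p = 0 := by
  have h0 : ∀ z ∈ S, hinge φ p z = 0 := fun z hz => max_eq_left (h z hz)
  unfold loss
  rw [Multiset.map_congr rfl h0]
  simp

theorem marginGap_comb (φ : X → H) (p q : H × ℝ) (s t : ℝ) (hst : s + t = 1) (z : X × Label) :
    marginGap φ (s • p + t • q) z = s * marginGap φ p z + t * marginGap φ q z := by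
  have : s = 1 - t := by linarith
  subst this
  simp only [marginGap, decisionValue, Prod.fst_add, Prod.smul_fst, Prod.snd_add, Prod.smul_snd,
    inner_add_left, real_inner_smul_left, smul_eq_mul]
  ring

theorem hinge_comb_le (φ : X → H) (p q : H × ℝ) {s t : ℝ} (hs : 0 ≤ s) (ht : 0 ≤ t)
    (hst : s + t = 1) (z : X × Label) :
    hinge φ (s • p + t • q) z ≤ s * hinge φ p z + t * hinge φ q z := by
  have h1 := mul_le_mul_of_nonneg_left (le_max_right 0 (marginGap φ p z)) hs
  have h2 := mul_le_mul_of_nonneg_left (le_max_right 0 (marginGap φ q z)) ht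
  have h3 := mul_nonneg hs (hinge_nonneg φ p z)
  have h4 := mul_nonneg ht (hinge_nonneg φ q z)
  refine max_le (by linarith) ?_
  rw [marginGap_comb φ p q s t hst]
  exact add_le_add h1 h2

theorem loss_comb_le (φ : X → H) (S : Multiset (X × Label)) (p q : H × ℝ) {s t : ℝ} (hs : 0 ≤ s)
    (ht : 0 ≤ t) (hst : s + t = 1) :
    loss φ S (s • p + t • q) ≤ s * loss φ S p + t * loss φ S q := by
  unfold loss
  rw [← Multiset.sum_map_mul_left, ← Multiset.sum_map_mul_left, ← Multiset.sum_map_add]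
  exact Multiset.sum_map_le_sum_map _ _ fun z _ => hinge_comb_le φ p q hs ht hst z

/-- The squared norm satisfies an exact identity along segments, which supplies the quadratic gain.
The gain involves only `w`; in `b` the cost is merely convex. -/
theorem cost_comb_le (φ : X → H) {ρ : ℝ} (hρ : 0 < ρ) (S : Multiset (X × Label)) (p q : H × ℝ)
    {s t : ℝ} (hs : 0 ≤ s) (ht : 0 ≤ t) (hst : s + t = 1) :
    cost φ ρ S (s • p + t • q) ≤
      s * cost φ ρ S p + t * cost φ ρ S q - s * t * ‖p.1 - q.1‖ ^ 2 := by
  have h1 := mul_le_mul_of_nonneg_left (loss_comb_le φ S p q hs ht hst) hρ.le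
  have h2 : ‖s • p.1 + t • q.1‖ ^ 2 =
      s * ‖p.1‖ ^ 2 + t * ‖q.1‖ ^ 2 - s * t * ‖p.1 - q.1‖ ^ 2 := by
    have : s = 1 - t := by linarith
    subst this
    rw [norm_add_sq_real, norm_sub_sq_real, norm_smul, norm_smul, real_inner_smul_left,
      real_inner_smul_right, mul_pow, mul_pow, Real.norm_eq_abs, Real.norm_eq_abs, sq_abs, sq_abs]
    ring
  unfold cost
  simp only [Prod.fst_add, Prod.smul_fst]
  rw [h2]
  linarith

theorem sum_toType {α : Type*} [DecidableEq α] (S : Multiset α) (f : α → ℝ) :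
    ∑ i : S.ToType, f i.1 = (S.map f).sum := by
  rw [← Multiset.map_univ S f]
  rfl

/-- For fixed `(w, b)` the hinge losses are the smallest feasible slacks, and `ρ > 0` makes them the
best ones. -/
theorem isOptimal_iff (φ : X → H) {ρ : ℝ} (hρ : 0 < ρ) (S : Multiset (X × Label)) (p : H × ℝ) :
    IsOptimal φ ρ S p ↔ ∀ q, cost φ ρ S p ≤ cost φ ρ S q := by
  classical
  have hfeas : ∀ q, Feasible φ S q fun i => hinge φ q i.1 := fun q i =>
    ⟨le_max_left _ _, le_max_right _ _⟩
  have hcost : ∀ q, objective ρ S q (fun i => hinge φ q i.1) = cost φ ρ S q := fun q => by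
    unfold objective cost loss
    rw [sum_toType S (hinge φ q)]
  have hle : ∀ q ξ, Feasible φ S q ξ → cost φ ρ S q ≤ objective ρ S q ξ := fun q ξ h => by
    rw [← hcost]
    unfold objective
    gcongr with i
    exact max_le (h i).1 (h i).2
  constructor
  · rintro ⟨ξ, h1, h2⟩ q
    exact (hle p ξ h1).trans ((h2 q _ (hfeas q)).trans (hcost q).le)
  · intro h
    exact ⟨_, hfeas p, fun q ξ hξ => (hcost p).le.trans ((h q).trans (hle q ξ hξ))⟩

/-- Optimality is tested against the midpoint of `p` and `q`, where strong convexity gains a quarter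
of the squared distance. -/
theorem IsOptimal.cost_add_le {φ : X → H} {ρ : ℝ} (hρ : 0 < ρ) {S : Multiset (X × Label)}
    {p : H × ℝ} (hp : IsOptimal φ ρ S p) (q : H × ℝ) :
    cost φ ρ S p + ‖p.1 - q.1‖ ^ 2 / 2 ≤ cost φ ρ S q := by
  have h1 := (isOptimal_iff φ hρ S p).1 hp ((1 / 2 : ℝ) • p + (1 / 2 : ℝ) • q)
  have h2 := cost_comb_le φ hρ S p q (s := 1 / 2) (t := 1 / 2) (by norm_num) (by norm_num)
    (by norm_num)
  linarith

theorem IsOptimal.fst_eq {φ : X → H} {ρ : ℝ} (hρ : 0 < ρ) {S : Multiset (X × Label)}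
    {p q : H × ℝ} (hp : IsOptimal φ ρ S p) (hq : cost φ ρ S q ≤ cost φ ρ S p) : q.1 = p.1 := by
  have h := hp.cost_add_le hρ q
  have : ‖p.1 - q.1‖ ^ 2 ≤ 0 := by linarith
  have : ‖p.1 - q.1‖ = 0 := by nlinarith [norm_nonneg (p.1 - q.1)]
  exact (sub_eq_zero.1 (norm_eq_zero.1 this)).symm

theorem isOptimal_of_cost_le {φ : X → H} {ρ : ℝ} (hρ : 0 < ρ) {S : Multiset (X × Label)}
    {p q : H × ℝ} (hp : IsOptimal φ ρ S p) (hq : cost φ ρ S q ≤ cost φ ρ S p) :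
    IsOptimal φ ρ S q :=
  (isOptimal_iff φ hρ S q).2 fun r => hq.trans ((isOptimal_iff φ hρ S p).1 hp r)

theorem IsOptimal.cost_eq {φ : X → H} {ρ : ℝ} (hρ : 0 < ρ) {S : Multiset (X × Label)}
    {p q : H × ℝ} (hp : IsOptimal φ ρ S p) (hq : IsOptimal φ ρ S q) :
    cost φ ρ S p = cost φ ρ S q :=
  le_antisymm ((isOptimal_iff φ hρ S p).1 hp q) ((isOptimal_iff φ hρ S q).1 hq p)

theorem IsOptimal.comb {φ : X → H} {ρ : ℝ} (hρ : 0 < ρ) {S : Multiset (X × Label)}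
    {p q : H × ℝ} (hp : IsOptimal φ ρ S p) (hq : IsOptimal φ ρ S q) {s t : ℝ} (hs : 0 ≤ s)
    (ht : 0 ≤ t) (hst : s + t = 1) : IsOptimal φ ρ S (s • p + t • q) := by
  refine isOptimal_of_cost_le hρ hp ?_
  have h1 := cost_comb_le φ hρ S p q hs ht hst
  have h2 : 0 ≤ s * t * ‖p.1 - q.1‖ ^ 2 := by positivity
  have h3 : s * cost φ ρ S p + t * cost φ ρ S p = cost φ ρ S p := by rw [← add_mul, hst, one_mul]
  rw [← hp.cost_eq hρ hq] at h1
  linarith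

/-- Two solutions share `w` and `|b|`. If their offsets were opposite, the midpoint would be optimal
with offset zero, so both offsets vanish. -/
theorem IsSolution.unique {φ : X → H} {ρ : ℝ} (hρ : 0 < ρ) {S : Multiset (X × Label)}
    {p q : H × ℝ} (hp : IsSolution φ ρ S p) (hq : IsSolution φ ρ S q) : p = q := by
  have h1 : q.1 = p.1 := hp.1.fst_eq hρ (hq.1.cost_eq hρ hp.1).le
  have h2 : |p.2| = |q.2| := le_antisymm (hp.2 q hq.1) (hq.2 p hp.1)
  refine Prod.ext h1.symm ?_
  rcases abs_eq_abs.1 h2 with h | h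
  · exact h
  · have h3 := hp.2 _ (hp.1.comb hρ hq.1 (s := 1 / 2) (t := 1 / 2) (by norm_num) (by norm_num)
      (by norm_num))
    have h4 : ((1 / 2 : ℝ) • p + (1 / 2 : ℝ) • q).2 = 0 := by simp [h]
    rw [h4, abs_zero] at h3
    have h5 : p.2 = 0 := abs_eq_zero.1 (le_antisymm h3 (abs_nonneg _))
    rw [h5] at h ⊢
    linarith

/-! ### Existence of the solution -/

theorem continuous_hinge (φ : X → H) (z : X × Label) : Continuous fun p => hinge φ p z := by
  unfold hinge marginGap decisionValue
  fun_prop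

theorem continuous_loss (φ : X → H) (S : Multiset (X × Label)) : Continuous (loss φ S) := by
  unfold loss
  exact continuous_multiset_sum _ fun z _ => continuous_hinge φ z

theorem continuous_cost (φ : X → H) (ρ : ℝ) (S : Multiset (X × Label)) :
    Continuous (cost φ ρ S) := by
  have := continuous_loss φ S
  unfold cost
  fun_prop

/-- Truncating `b` at a level beyond all the kinks of the hinge losses does not increase them. -/
theorem hinge_clamp_le (φ : X → H) (w : H) (b : ℝ) {R : ℝ} (z : X × Label)
    (hR : 1 + |inner ℝ w (φ z.1)| ≤ R) :
    hinge φ (w, max (-R) (min R b)) z ≤ hinge φ (w, b) z := by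
  obtain ⟨x, y, hy⟩ := z
  have h1 := neg_abs_le (inner ℝ w (φ x) : ℝ)
  have h2 := le_abs_self (inner ℝ w (φ x) : ℝ)
  simp only at hR
  simp only [hinge, marginGap, decisionValue]
  set a : ℝ := inner ℝ w (φ x)
  have h3 := abs_nonneg a
  have hR0 : -R ≤ R := by linarith
  have h0 : ∀ s t : ℝ, s ≤ 0 → max 0 s ≤ max 0 t := fun s t hs =>
    (max_eq_left hs).le.trans (le_max_left _ _)
  have h4 : ∀ s t : ℝ, s ≤ t → max 0 s ≤ max 0 t := fun s t hs => max_le_max le_rfl hs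
  rcases le_total R b with hb | hb
  · rw [min_eq_left hb, max_eq_right hR0]
    rcases hy with rfl | rfl
    · exact h4 _ _ (by linarith)
    · exact h0 _ _ (by linarith)
  · rw [min_eq_right hb]
    rcases le_total (-R) b with hb' | hb'
    · rw [max_eq_right hb']
    · rw [max_eq_left hb']
      rcases hy with rfl | rfl
      · exact h0 _ _ (by linarith)
      · exact h4 _ _ (by linarith)

/-- The span of the feature vectors of the instances in `S`. -/
def featureSpan (φ : X → H) (S : Multiset (X × Label)) : Submodule ℝ H :=
  Submodule.span ℝ ((fun z : X × Label => φ z.1) '' {z | z ∈ S})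

instance (φ : X → H) (S : Multiset (X × Label)) : FiniteDimensional ℝ (featureSpan φ S) :=
  FiniteDimensional.span_of_finite ℝ ((Multiset.finite_toSet S).image _)

/-- Projecting `w` onto the span of the features preserves all scores on `S` and does not increase
the norm; clamping `b` does not increase the loss. The search is thereby confined to a compact set
in finite dimension. -/
theorem exists_isOptimal (φ : X → H) {ρ : ℝ} (hρ : 0 < ρ) (S : Multiset (X × Label)) :
    ∃ p, IsOptimal φ ρ S p ∧ p.1 ∈ featureSpan φ S := by
  classical
  -- A `w` of norm beyond `r` costs more than the zero pair through its norm alone.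
  set r : ℝ := Real.sqrt (cost φ ρ S 0) with hr
  have hr0 : 0 ≤ r := Real.sqrt_nonneg _
  set R : ℝ := 1 + ∑ z ∈ S.toFinset, r * ‖φ z.1‖ with hRdef
  have hR0 : 0 ≤ R := by positivity
  have hR : ∀ w : H, ‖w‖ ≤ r → ∀ z ∈ S, 1 + |inner ℝ w (φ z.1)| ≤ R := by
    intro w hw z hz
    have h1 : r * ‖φ z.1‖ ≤ ∑ z ∈ S.toFinset, r * ‖φ z.1‖ :=
      Finset.single_le_sum (f := fun z : X × Label => r * ‖φ z.1‖) (fun _ _ => by positivity)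
        (Multiset.mem_toFinset.2 hz)
    have h2 := abs_real_inner_le_norm w (φ z.1)
    have h3 : ‖w‖ * ‖φ z.1‖ ≤ r * ‖φ z.1‖ := by gcongr
    linarith
  have hK : IsCompact (Metric.closedBall (0 : featureSpan φ S) r ×ˢ Set.Icc (-R) R) := by
    have : ProperSpace (featureSpan φ S) := FiniteDimensional.proper ℝ _
    exact (isCompact_closedBall _ _).prod isCompact_Icc
  have hcont : Continuous fun q : featureSpan φ S × ℝ => cost φ ρ S (q.1, q.2) :=
    (continuous_cost φ ρ S).comp (by fun_prop)
  obtain ⟨q, hqK, hq⟩ := hK.exists_isMinOn ⟨(0, 0), by simp [hr0, hR0]⟩ hcont.continuousOn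
  refine ⟨(q.1, q.2), (isOptimal_iff φ hρ S _).2 fun p => ?_, q.1.2⟩
  have h0 : cost φ ρ S (q.1, q.2) ≤ cost φ ρ S 0 := isMinOn_iff.1 hq (0, 0) (by simp [hr0, hR0])
  by_cases hp : ‖p.1‖ ≤ r
  · let w : featureSpan φ S := (featureSpan φ S).orthogonalProjectionOnto p.1
    have hw : ‖(w : H)‖ ≤ ‖p.1‖ := (featureSpan φ S).norm_orthogonalProjectionOnto_apply_le p.1
    have hinner : ∀ z ∈ S, (inner ℝ (w : H) (φ z.1) : ℝ) = inner ℝ p.1 (φ z.1) := fun z hz => by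
      have hz' : φ z.1 ∈ featureSpan φ S := Submodule.subset_span ⟨z, hz, rfl⟩
      exact (featureSpan φ S).inner_orthogonalProjectionOnto_eq_of_mem_right ⟨_, hz'⟩ p.1
    have h1 := isMinOn_iff.1 hq (w, max (-R) (min R p.2)) ⟨by simpa using hw.trans hp,
      le_max_left _ _, max_le (by linarith) (min_le_left _ _)⟩
    refine le_trans h1 ?_
    have h2 : loss φ S ((w : H), max (-R) (min R p.2)) ≤ loss φ S p := by
      refine Multiset.sum_map_le_sum_map _ _ fun z hz => ?_
      refine (hinge_clamp_le φ (w : H) p.2 z (hR _ (hw.trans hp) z hz)).trans (le_of_eq ?_)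
      simp only [hinge, marginGap, decisionValue, hinner z hz]
    show ‖(w : H)‖ ^ 2 + ρ * loss φ S _ ≤ ‖p.1‖ ^ 2 + ρ * loss φ S p
    gcongr
  · have h1 : cost φ ρ S 0 < ‖p.1‖ ^ 2 := (Real.sqrt_lt' (hr0.trans_lt (not_le.1 hp))).1 (not_le.1 hp)
    have h2 := mul_nonneg hρ.le (loss_nonneg φ S p)
    refine h0.trans (h1.le.trans ?_)
    unfold cost
    linarith

/-- All optima share `w`, so only `b` varies, and offsets larger in modulus than a known optimal one
may be ignored: `|b|` is minimized on a compact set. -/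
theorem exists_isSolution (φ : X → H) {ρ : ℝ} (hρ : 0 < ρ) (S : Multiset (X × Label)) :
    ∃ p, IsSolution φ ρ S p := by
  obtain ⟨p, hp, -⟩ := exists_isOptimal φ hρ S
  have hcont : Continuous fun b : ℝ => cost φ ρ S (p.1, b) :=
    (continuous_cost φ ρ S).comp (by fun_prop)
  have hK : IsCompact (Set.Icc (-|p.2|) |p.2| ∩ {b : ℝ | cost φ ρ S (p.1, b) ≤ cost φ ρ S p}) :=
    isCompact_Icc.inter_right (isClosed_le hcont continuous_const)
  obtain ⟨b, ⟨hb1, hb2⟩, hb⟩ := hK.exists_isMinOn ⟨p.2, ⟨neg_abs_le _, le_abs_self _⟩, (le_rfl : cost φ ρ S p ≤ cost φ ρ S p)⟩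
    continuous_abs.continuousOn
  refine ⟨(p.1, b), isOptimal_of_cost_le hρ hp hb2, fun q hq => ?_⟩
  rcases le_total |q.2| |p.2| with h | h
  · refine hb ⟨abs_le.1 h, ?_⟩
    have h1 : q.1 = p.1 := hp.fst_eq hρ (hq.cost_eq hρ hp).le
    show cost φ ρ S (p.1, q.2) ≤ _
    rw [← h1]
    exact (hq.cost_eq hρ hp).le
  · exact (abs_le.2 hb1).trans h

theorem isSolution_solution (φ : X → H) {ρ : ℝ} (hρ : 0 < ρ) (S : Multiset (X × Label)) :
    IsSolution φ ρ S (solution φ ρ S) :=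
  Classical.epsilon_spec (exists_isSolution φ hρ S)

theorem solution_eq {φ : X → H} {ρ : ℝ} (hρ : 0 < ρ) {S : Multiset (X × Label)} {p : H × ℝ}
    (hp : IsSolution φ ρ S p) : solution φ ρ S = p :=
  (isSolution_solution φ hρ S).unique hρ hp

theorem solution_fst_mem_featureSpan (φ : X → H) {ρ : ℝ} (hρ : 0 < ρ)
    (S : Multiset (X × Label)) : (solution φ ρ S).1 ∈ featureSpan φ S := by
  obtain ⟨p, hp, hpm⟩ := exists_isOptimal φ hρ S
  have hs := (isSolution_solution φ hρ S).1
  rwa [hp.fst_eq hρ (hs.cost_eq hρ hp).le]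

/-! ### Stability of the solution under adding and dropping examples -/

/-- Adding examples that the solution fits with margin does not change the solution. -/
theorem solution_add_eq {φ : X → H} {ρ : ℝ} (hρ : 0 < ρ) {V T : Multiset (X × Label)}
    (hT : ∀ z ∈ T, marginGap φ (solution φ ρ V) z ≤ 0) :
    solution φ ρ (V + T) = solution φ ρ V := by
  have hV := isSolution_solution φ hρ V
  have hmono : ∀ q, cost φ ρ V q ≤ cost φ ρ (V + T) q := fun q => by
    have := mul_nonneg hρ.le (loss_nonneg φ T q)
    simp only [cost, loss_add]
    linarith
  have heq : cost φ ρ (V + T) (solution φ ρ V) = cost φ ρ V (solution φ ρ V) := by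
    simp [cost, loss_add, loss_eq_zero hT]
  have hopt : IsOptimal φ ρ (V + T) (solution φ ρ V) := (isOptimal_iff φ hρ _ _).2 fun q =>
    heq.le.trans (((isOptimal_iff φ hρ V _).1 hV.1 q).trans (hmono q))
  refine solution_eq hρ ⟨hopt, fun q hq => hV.2 q (isOptimal_of_cost_le hρ hV.1 ?_)⟩
  exact (hmono q).trans ((hq.cost_eq hρ hopt).trans heq).le

/-- Dropping examples that lie strictly beyond the margin does not change the solution. -/
theorem solution_eq_of_neg {φ : X → H} {ρ : ℝ} (hρ : 0 < ρ) {V T : Multiset (X × Label)}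
    (hT : ∀ z ∈ T, marginGap φ (solution φ ρ (V + T)) z < 0) :
    solution φ ρ V = solution φ ρ (V + T) := by
  set p := solution φ ρ (V + T) with hpdef
  have hp : IsSolution φ ρ (V + T) p := isSolution_solution φ hρ (V + T)
  have heq : cost φ ρ (V + T) p = cost φ ρ V p := by
    simp [cost, loss_add, loss_eq_zero fun z hz => (hT z hz).le]
  -- Strict inequalities persist near `p`, so a short step towards `q` still incurs no loss on `T`.
  -- Convexity then turns this local comparison of costs, and of `|b|`, into a global one.
  have key : ∀ q, ∃ t : ℝ, 0 < t ∧ t < 1 ∧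
      cost φ ρ (V + T) ((1 - t) • p + t • q) = cost φ ρ V ((1 - t) • p + t • q) := by
    intro q
    have h1 : ∀ᶠ t in nhdsWithin (0 : ℝ) (Set.Ioi 0),
        ∀ z ∈ {z | z ∈ T}, marginGap φ ((1 - t) • p + t • q) z < 0 := by
      refine (Filter.eventually_all_finite (Multiset.finite_toSet T)).2 fun z hz => ?_
      have hc : Continuous fun t : ℝ => marginGap φ ((1 - t) • p + t • q) z := by
        unfold marginGap decisionValue
        simp only [Prod.fst_add, Prod.smul_fst, Prod.snd_add, Prod.smul_snd]
        fun_prop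
      refine Filter.Eventually.filter_mono nhdsWithin_le_nhds ?_
      refine hc.continuousAt.eventually_lt continuousAt_const ?_
      simpa using hT z hz
    obtain ⟨t, ht1, ht2⟩ := (h1.and (Ioo_mem_nhdsGT (zero_lt_one (α := ℝ)))).exists
    refine ⟨t, ht2.1, ht2.2, ?_⟩
    simp [cost, loss_add, loss_eq_zero fun z hz => (ht1 z hz).le]
  have hV : IsOptimal φ ρ V p := by
    refine (isOptimal_iff φ hρ V p).2 fun q => ?_
    obtain ⟨t, ht0, ht1, ht⟩ := key q
    have h1 := (isOptimal_iff φ hρ _ p).1 hp.1 ((1 - t) • p + t • q)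
    have h2 := cost_comb_le φ hρ V p q (s := 1 - t) (t := t) (by linarith) ht0.le (by ring)
    have h3 : 0 ≤ (1 - t) * t * ‖p.1 - q.1‖ ^ 2 := by
      have : 0 ≤ 1 - t := by linarith
      positivity
    rw [heq, ht] at h1
    by_contra! h4
    nlinarith [mul_lt_mul_of_pos_left h4 ht0]
  refine solution_eq hρ ⟨hV, fun q hq => ?_⟩
  obtain ⟨t, ht0, ht1, ht⟩ := key q
  have h1 := hV.comb hρ hq (s := 1 - t) (t := t) (by linarith) ht0.le (by ring)
  have h2 := hp.2 _ (isOptimal_of_cost_le hρ hp.1 (ht.trans ((h1.cost_eq hρ hV).trans heq.symm)).le)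
  have h3 : |((1 - t) • p + t • q).2| ≤ (1 - t) * |p.2| + t * |q.2| := by
    refine (abs_add_le _ _).trans_eq ?_
    simp [abs_mul, abs_of_pos ht0, abs_of_pos (by linarith : 0 < 1 - t)]
  by_contra! h4
  nlinarith [mul_lt_mul_of_pos_left h4 ht0]

end Program

end SVMRisk

end

noncomputable section

namespace SVMRisk

/-! ### Compression sets of indices -/

section CompressionSets

variable {X : Type*} {H : Type*} [NormedAddCommGroup H] [InnerProductSpace ℝ H] {N : ℕ}

/-- The multiset of the examples with index in `I`. -/
def subsample (z : Fin N → X × Label) (I : Finset (Fin N)) : Multiset (X × Label) := I.val.map z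

theorem subsample_add_sdiff (z : Fin N → X × Label) {I J : Finset (Fin N)} (h : I ⊆ J) :
    subsample z I + subsample z (J \ I) = subsample z J := by
  unfold subsample
  rw [← Multiset.map_add, Finset.sdiff_val, add_tsub_cancel_of_le (Finset.val_le_iff.2 h)]

theorem subsample_disjUnion (z : Fin N → X × Label) {I J : Finset (Fin N)} (h : Disjoint I J) :
    subsample z (I.disjUnion J h) = subsample z I + subsample z J :=
  Multiset.map_add _ _ _

theorem forall_mem_subsample {z : Fin N → X × Label} {I : Finset (Fin N)}
    {P : X × Label → Prop} : (∀ a ∈ subsample z I, P a) ↔ ∀ i ∈ I, P (z i) := by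
  simp [subsample, Multiset.mem_map]

theorem subsample_update {z : Fin N → X × Label} {I : Finset (Fin N)} {j : Fin N} (hj : j ∉ I)
    (a : X × Label) : subsample (Function.update z j a) I = subsample z I :=
  Multiset.map_congr rfl fun _ hi => Function.update_of_ne (ne_of_mem_of_not_mem hi hj) _ _

/-- A sublist of a mapped list is the map of a sublist, so repeated examples can be told apart by
their indices. -/
theorem exists_subsample_eq {z : Fin N → X × Label} {T : Multiset (X × Label)}
    (h : T ≤ trainingSet z) : ∃ K, subsample z K = T := by
  obtain ⟨u, hu, hT⟩ : ∃ u ≤ Finset.univ.val, u.map z = T := by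
    have h' : (Finset.univ.val.map z) = ((List.ofFn z : List _) : Multiset (X × Label)) := by
      simp [List.ofFn_eq_map]
    rw [trainingSet, h'] at h
    obtain ⟨l, rfl⟩ := Quot.exists_rep T
    obtain ⟨l', hl', hs⟩ := (Multiset.coe_le.1 h : l.Subperm _)
    rw [List.ofFn_eq_map] at hs
    obtain ⟨m, hm, rfl⟩ := List.sublist_map_iff.1 hs
    refine ⟨m, ?_, ?_⟩
    · exact Multiset.coe_le.2 hm.subperm
    · rw [Multiset.map_coe]
      exact Quot.sound hl'
  exact ⟨⟨u, Multiset.nodup_of_le hu Finset.univ.nodup⟩, hT⟩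

/-- The indices in `I ⊆ J` include those of all the examples of the sample `J` inside the margin,
and the other ones are on the margin; and the examples in `I` have the same solution. -/
structure IsRepresentative (φ : X → H) (ρ : ℝ) (z : Fin N → X × Label) (J I : Finset (Fin N)) :
    Prop where
  subset : I ⊆ J
  nonneg : ∀ i ∈ I, 0 ≤ marginGap φ (solution φ ρ (subsample z J)) (z i)
  mem_of_pos : ∀ i ∈ J, 0 < marginGap φ (solution φ ρ (subsample z J)) (z i) → i ∈ I
  solution_eq : solution φ ρ (subsample z I) = solution φ ρ (subsample z J)

/-- A representative set of indices of smallest cardinality. -/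
structure IsCompressionSet (φ : X → H) (ρ : ℝ) (z : Fin N → X × Label) (J I : Finset (Fin N)) :
    Prop where
  isRepresentative : IsRepresentative φ ρ z J I
  card_le : ∀ I', IsRepresentative φ ρ z J I' → I.card ≤ I'.card

variable {φ : X → H} {ρ : ℝ} {z : Fin N → X × Label} {I J : Finset (Fin N)}

/-- All indices with nonnegative gap will do: the discarded examples lie strictly beyond the margin.
-/
theorem exists_isRepresentative (φ : X → H) (hρ : 0 < ρ) (z : Fin N → X × Label)
    (J : Finset (Fin N)) : ∃ I, IsRepresentative φ ρ z J I := by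
  classical
  set I := J.filter fun i => 0 ≤ marginGap φ (solution φ ρ (subsample z J)) (z i)
  have hsub : I ⊆ J := Finset.filter_subset _ _
  refine ⟨I, hsub, fun i hi => (Finset.mem_filter.1 hi).2,
    fun i hi h => Finset.mem_filter.2 ⟨hi, h.le⟩, ?_⟩
  rw [← subsample_add_sdiff z hsub]
  refine solution_eq_of_neg hρ (forall_mem_subsample.2 fun i hi => ?_)
  rw [subsample_add_sdiff z hsub]
  obtain ⟨h1, h2⟩ := Finset.mem_sdiff.1 hi
  exact not_le.1 fun h => h2 (Finset.mem_filter.2 ⟨h1, h⟩)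

theorem exists_isCompressionSet (φ : X → H) (hρ : 0 < ρ) (z : Fin N → X × Label)
    (J : Finset (Fin N)) : ∃ I, IsCompressionSet φ ρ z J I := by
  classical
  obtain ⟨I₀, h₀⟩ := exists_isRepresentative φ hρ z J
  obtain ⟨I, hI, hmin⟩ := Finset.exists_min_image
    (Finset.univ.filter fun I => IsRepresentative φ ρ z J I) Finset.card
    ⟨I₀, by simpa using h₀⟩
  exact ⟨I, by simpa using hI, fun I' h' => hmin I' (by simpa using h')⟩

theorem IsRepresentative.marginGap_nonpos {K : Finset (Fin N)} (h : IsRepresentative φ ρ z K I)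
    {j : Fin N} (hj : j ∈ K) (hjI : j ∉ I) :
    marginGap φ (solution φ ρ (subsample z I)) (z j) ≤ 0 := by
  rw [h.solution_eq]
  exact not_lt.1 fun h' => hjI (h.mem_of_pos j hj h')

/-- The examples of `J` outside `I` have nonpositive gap at the solution of `I`, so adding them
changes nothing. -/
theorem IsRepresentative.solution_eq_of_subset (hρ : 0 < ρ) {K : Finset (Fin N)}
    (h : IsRepresentative φ ρ z K I) (hI : I ⊆ J) (hJ : J ⊆ K) :
    solution φ ρ (subsample z J) = solution φ ρ (subsample z K) := by
  rw [← h.solution_eq, ← subsample_add_sdiff z hI]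
  refine solution_add_eq hρ (forall_mem_subsample.2 fun i hi => ?_)
  obtain ⟨h1, h2⟩ := Finset.mem_sdiff.1 hi
  exact h.marginGap_nonpos (hJ h1) h2

theorem IsRepresentative.of_subset (hρ : 0 < ρ) {K : Finset (Fin N)}
    (h : IsRepresentative φ ρ z K I) (hI : I ⊆ J) (hJ : J ⊆ K) : IsRepresentative φ ρ z J I := by
  have hsol := h.solution_eq_of_subset hρ hI hJ
  refine ⟨hI, ?_, ?_, ?_⟩ <;> rw [hsol]
  · exact h.nonneg
  · exact fun i hi => h.mem_of_pos i (hJ hi)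
  · exact h.solution_eq

/-- The samples `J` and `K` have the same solution, and the examples of `K` with positive gap are
already in `I ⊆ J`; hence `I'` contains them. -/
theorem IsRepresentative.extend (hρ : 0 < ρ) {K I' : Finset (Fin N)}
    (h : IsRepresentative φ ρ z K I) (hI : I ⊆ J) (hJ : J ⊆ K)
    (h' : IsRepresentative φ ρ z J I') : IsRepresentative φ ρ z K I' := by
  have hsol := h.solution_eq_of_subset hρ hI hJ
  refine ⟨h'.subset.trans hJ, ?_, ?_, ?_⟩ <;> rw [← hsol]
  · exact h'.nonneg
  · intro i hi hpos
    exact h'.mem_of_pos i (hI (h.mem_of_pos i hi (hsol ▸ hpos))) hpos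
  · exact h'.solution_eq

theorem IsCompressionSet.of_subset (hρ : 0 < ρ) {K : Finset (Fin N)}
    (h : IsCompressionSet φ ρ z K I) (hI : I ⊆ J) (hJ : J ⊆ K) : IsCompressionSet φ ρ z J I :=
  ⟨h.1.of_subset hρ hI hJ, fun I' h' => h.2 I' (h.1.extend hρ hI hJ h')⟩

theorem IsCompressionSet.extend (hρ : 0 < ρ) {K I' : Finset (Fin N)}
    (h : IsCompressionSet φ ρ z K I) (hI : I ⊆ J) (hJ : J ⊆ K)
    (h' : IsCompressionSet φ ρ z J I') : IsCompressionSet φ ρ z K I' :=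
  ⟨h.1.extend hρ hI hJ h'.1, fun I'' h'' =>
    (h'.2 I (h.1.of_subset hρ hI hJ)).trans (h.2 I'' h'')⟩

/-- A nonpositive gap forces a score of modulus at least 1 with the sign of the label, so the
convention at score zero is irrelevant. -/
theorem svm_eq_of_marginGap_nonpos {S : Multiset (X × Label)} {a : X × Label}
    (h : marginGap φ (solution φ ρ S) a ≤ 0) : svm φ ρ S a.1 = a.2 := by
  obtain ⟨x, y, hy⟩ := a
  simp only [marginGap] at h
  unfold svm
  refine Subtype.ext ?_
  rcases hy with rfl | rfl
  · rw [if_neg (by linarith)]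
  · rw [if_pos (by linarith)]

/-- The instances outside of a compression set are classified correctly. -/
theorem IsCompressionSet.svm_eq (h : IsCompressionSet φ ρ z J I) {j : Fin N} (hj : j ∈ J)
    (hjI : j ∉ I) : svm φ ρ (subsample z I) (z j).1 = (z j).2 :=
  svm_eq_of_marginGap_nonpos (h.1.marginGap_nonpos hj hjI)

theorem IsCompressionSet.svm_subsample_eq (h : IsCompressionSet φ ρ z J I) :
    svm φ ρ (subsample z I) = svm φ ρ (subsample z J) := by
  funext x
  unfold svm
  rw [h.1.solution_eq]

/-! ### From sets of indices to the multiset compression -/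

/-- Representative sets of indices correspond to the supports. -/
theorem IsRepresentative.exists_isSupport (h : IsRepresentative φ ρ z Finset.univ I) :
    ∃ T, IsSupport φ ρ (trainingSet z) T ∧
      I.card = (violating φ ρ (trainingSet z)).card + T.card := by
  classical
  have hS : subsample z Finset.univ = trainingSet z := rfl
  obtain ⟨-, hnn, hpos, hsol⟩ := h
  rw [hS] at hnn hpos hsol
  set p := solution φ ρ (trainingSet z) with hp
  -- Every index with positive gap belongs to `I`; the remaining indices of `I` have gap zero and
  -- form `T`.
  have hviol : violating φ ρ (trainingSet z) =
      subsample z (I.filter fun i => 0 < marginGap φ p (z i)) := by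
    unfold violating trainingSet subsample
    rw [Multiset.filter_map]
    have : (Finset.univ.filter fun i => 0 < marginGap φ p (z i)) =
        I.filter fun i => 0 < marginGap φ p (z i) := by
      ext i
      simp only [Finset.mem_filter, Finset.mem_univ, true_and]
      exact ⟨fun h => ⟨hpos i (Finset.mem_univ _) h, h⟩, fun h => h.2⟩
    rw [← this, Finset.filter_val]
    rfl
  have hadd := subsample_add_sdiff z
    (Finset.filter_subset (fun i => 0 < marginGap φ p (z i)) I)
  rw [← hviol] at hadd
  refine ⟨_, ⟨?_, forall_mem_subsample.2 fun i hi => ?_, by rw [hadd, hsol]⟩, ?_⟩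
  · exact Multiset.map_le_map (Finset.val_le_iff.2 (Finset.subset_univ _))
  · simp only [Finset.mem_sdiff, Finset.mem_filter, not_and, not_lt] at hi
    exact le_antisymm (hi.2 hi.1) (hnn i hi.1)
  · rw [← Multiset.card_add, hadd]
    simp [subsample]

theorem IsSupport.exists_isRepresentative {T : Multiset (X × Label)}
    (h : IsSupport φ ρ (trainingSet z) T) :
    ∃ I, IsRepresentative φ ρ z Finset.univ I ∧
      I.card = (violating φ ρ (trainingSet z)).card + T.card := by
  classical
  obtain ⟨hle, hgap, hsol⟩ := h
  obtain ⟨K, rfl⟩ := exists_subsample_eq hle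
  rw [forall_mem_subsample] at hgap
  set p := solution φ ρ (trainingSet z) with hp
  have hviol : violating φ ρ (trainingSet z) =
      subsample z (Finset.univ.filter fun i => 0 < marginGap φ p (z i)) := by
    unfold violating trainingSet subsample
    rw [Multiset.filter_map, Finset.filter_val]
    rfl
  have hdisj : Disjoint (Finset.univ.filter fun i => 0 < marginGap φ p (z i)) K := by
    refine Finset.disjoint_left.2 fun i hi hK => ?_
    have := (Finset.mem_filter.1 hi).2
    rw [hgap i hK] at this
    exact lt_irrefl _ this
  rw [hviol, ← subsample_disjUnion z hdisj] at hsol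
  refine ⟨_, ⟨Finset.subset_univ _, fun i hi => ?_, fun i _ hi => ?_, hsol⟩, ?_⟩
  · show 0 ≤ marginGap φ p (z i)
    rcases Finset.mem_disjUnion.1 hi with hi | hi
    · exact (Finset.mem_filter.1 hi).2.le
    · exact (hgap i hi).ge
  · exact Finset.mem_disjUnion.2 (Or.inl (Finset.mem_filter.2 ⟨Finset.mem_univ _, hi⟩))
  · rw [Finset.card_disjUnion, hviol]
    simp only [subsample, Multiset.card_map]
    rfl

/-- There are finitely many sub-multisets, so both successive minima are attained. -/
theorem exists_isSelectedSupport [LinearOrder X] {S T₀ : Multiset (X × Label)}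
    (h₀ : IsSupport φ ρ S T₀) : ∃ T, IsSelectedSupport φ ρ S T := by
  classical
  obtain ⟨T₁, h₁, hmin₁⟩ := Finset.exists_min_image
    (S.powerset.toFinset.filter fun T => IsSupport φ ρ S T) Multiset.card
    ⟨T₀, by simpa using ⟨h₀.1, h₀⟩⟩
  have hmin : IsMinSupport φ ρ S T₁ :=
    ⟨(Finset.mem_filter.1 h₁).2, fun T' h' => hmin₁ T' (by simpa using ⟨h'.1, h'⟩)⟩
  obtain ⟨T, h, hsel⟩ := Finset.exists_min_image
    (S.powerset.toFinset.filter fun T => IsMinSupport φ ρ S T) sortedInstances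
    ⟨T₁, by simpa using ⟨hmin.1.1, hmin⟩⟩
  exact ⟨T, (Finset.mem_filter.1 h).2, fun T' h' => hsel T' (by simpa using ⟨h'.1.1, h'⟩)⟩

/-- All the compression sets of indices have the cardinality of the compression. -/
theorem IsCompressionSet.card_compression [LinearOrder X]
    (h : IsCompressionSet φ ρ z Finset.univ I) :
    (compression φ ρ (trainingSet z)).card = I.card := by
  obtain ⟨T, hT, hcard⟩ := h.1.exists_isSupport
  have hsel : IsSelectedSupport φ ρ (trainingSet z) (selectedSupport φ ρ (trainingSet z)) :=
    Classical.epsilon_spec (exists_isSelectedSupport hT)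
  obtain ⟨I', hI', hcard'⟩ := hsel.1.1.exists_isRepresentative
  have h1 := h.2 I' hI'
  have h2 := hsel.1.2 T hT
  rw [compression, Multiset.card_add]
  omega

end CompressionSets

end SVMRisk

end

noncomputable section

namespace SVMRisk

/-! ### Measurability of the solution -/

section Measurability

open Filter Topology

variable {X : Type*} {H : Type*} [NormedAddCommGroup H] [InnerProductSpace ℝ H] {N : ℕ}

/-- Approximate minimizers of the costs with a vanishing penalty on `b` converge to the
solution. -/
theorem tendsto_solution {φ : X → H} {ρ : ℝ} (hρ : 0 < ρ) {S : Multiset (X × Label)}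
    {ε : ℕ → ℝ} (hε : ∀ n, 0 < ε n) (hε0 : Tendsto ε atTop (𝓝 0)) {p : ℕ → H × ℝ}
    (hp : ∀ n, cost φ ρ S (p n) + ε n * (p n).2 ^ 2 ≤
      cost φ ρ S (solution φ ρ S) + ε n * (solution φ ρ S).2 ^ 2 + ε n ^ 2) :
    Tendsto p atTop (𝓝 (solution φ ρ S)) := by
  have hs := isSolution_solution φ hρ S
  set s := solution φ ρ S
  have hlow : ∀ n, cost φ ρ S s + ‖s.1 - (p n).1‖ ^ 2 / 2 ≤ cost φ ρ S (p n) := fun n =>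
    hs.1.cost_add_le hρ (p n)
  have hlim : Tendsto (fun n => ε n * s.2 ^ 2 + ε n ^ 2) atTop (𝓝 0) := by
    simpa using (hε0.mul_const (s.2 ^ 2)).add (hε0.pow 2)
  have hw : Tendsto (fun n => (p n).1) atTop (𝓝 s.1) := by
    rw [tendsto_iff_norm_sub_tendsto_zero]
    have h1 : Tendsto (fun n => ‖(p n).1 - s.1‖ ^ 2) atTop (𝓝 0) := by
      refine squeeze_zero (fun n => by positivity) (fun n => ?_)
        (by simpa using hlim.const_mul 2)
      have h2 := hlow n
      have h3 := mul_nonneg (hε n).le (sq_nonneg (p n).2)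
      rw [norm_sub_rev]
      linarith [hp n]
    simpa [Real.sqrt_sq (norm_nonneg _)] using h1.sqrt
  -- Dividing by the penalty `ε n` is the reason for the tolerance `ε n ^ 2`: an error that still
  -- vanishes is left.
  have hb : ∀ n, (p n).2 ^ 2 ≤ s.2 ^ 2 + ε n := fun n => by
    have h2 := hlow n
    have h3 : 0 ≤ ‖s.1 - (p n).1‖ ^ 2 := by positivity
    have h4 : ε n * (p n).2 ^ 2 ≤ ε n * (s.2 ^ 2 + ε n) := by linarith [hp n]
    exact le_of_mul_le_mul_left h4 (hε n)
  obtain ⟨B, hB⟩ := hε0.bddAbove_range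
  have hbB : ∀ n, (p n).2 ∈ Metric.closedBall (0 : ℝ) (Real.sqrt (s.2 ^ 2 + B)) := fun n => by
    rw [mem_closedBall_zero_iff, Real.norm_eq_abs]
    exact Real.abs_le_sqrt ((hb n).trans (by linarith [hB ⟨n, rfl⟩]))
  -- The offsets are bounded. Any cluster point is optimal with `|b|` at most that of `s`, hence
  -- equals `s` by uniqueness.
  refine tendsto_of_subseq_tendsto fun ns hns => ?_
  obtain ⟨b, -, ms, hms, hlimb⟩ := (isCompact_closedBall (0 : ℝ) _).tendsto_subseq
    fun n => hbB (ns n)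
  have hsub : Tendsto (fun n => ns (ms n)) atTop atTop := hns.comp hms.tendsto_atTop
  have hpsub : Tendsto (fun n => p (ns (ms n))) atTop (𝓝 (s.1, b)) :=
    (hw.comp hsub).prodMk_nhds hlimb
  refine ⟨ms, ?_⟩
  suffices (s.1, b) = s by rwa [this] at hpsub
  have hcost : cost φ ρ S (s.1, b) ≤ cost φ ρ S s := by
    have h1 := ((continuous_cost φ ρ S).tendsto _).comp hpsub
    have h2 := (hlim.comp hsub).const_add (cost φ ρ S s)
    rw [add_zero] at h2
    refine le_of_tendsto_of_tendsto' h1 h2 fun n => ?_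
    have h3 := mul_nonneg (hε (ns (ms n))).le (sq_nonneg (p (ns (ms n))).2)
    simp only [Function.comp]
    linarith [hp (ns (ms n))]
  have hbs : |b| ≤ |s.2| := by
    refine sq_le_sq.1 ?_
    have h2 := (hε0.comp hsub).const_add (s.2 ^ 2)
    rw [add_zero] at h2
    exact le_of_tendsto_of_tendsto' (hlimb.pow 2) h2 fun n => hb _
  have hopt := isOptimal_of_cost_le hρ hs.1 hcost
  exact IsSolution.unique hρ ⟨hopt, fun q hq => hbs.trans (hs.2 q hq)⟩ hs

/-- The pair `(w, b)` in which `w` is the combination with coefficients `c.1` of the feature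
vectors of the examples with index in `I`. -/
def combination (φ : X → H) (z : Fin N → X × Label) (I : Finset (Fin N))
    (c : (Fin N → ℝ) × ℝ) : H × ℝ :=
  (∑ i ∈ I, c.1 i • φ (z i).1, c.2)

theorem exists_combination_eq_solution (φ : X → H) {ρ : ℝ} (hρ : 0 < ρ)
    (z : Fin N → X × Label) (I : Finset (Fin N)) :
    ∃ c, combination φ z I c = solution φ ρ (subsample z I) := by
  have h := solution_fst_mem_featureSpan φ hρ (subsample z I)
  have himg : (fun a : X × Label => φ a.1) '' {a | a ∈ subsample z I} =
      (fun i => φ (z i).1) '' (I : Set (Fin N)) := by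
    ext v
    simp [subsample]
  rw [featureSpan, himg, Submodule.mem_span_image_finset_iff_exists_fun'] at h
  obtain ⟨c, hc⟩ := h
  exact ⟨(c, (solution φ ρ (subsample z I)).2), Prod.ext hc rfl⟩

theorem continuous_combination (φ : X → H) (z : Fin N → X × Label) (I : Finset (Fin N)) :
    Continuous (combination φ z I) := by
  unfold combination
  fun_prop

theorem decisionValue_combination (φ : X → H) (z : Fin N → X × Label) (I : Finset (Fin N))
    (c : (Fin N → ℝ) × ℝ) (x : X) :
    decisionValue φ (combination φ z I c) x =
      ∑ i ∈ I, c.1 i * inner ℝ (φ (z i).1) (φ x) + c.2 := by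
  simp [decisionValue, combination, sum_inner, real_inner_smul_left]

variable [MeasurableSpace X]

theorem measurable_kernel_eval {φ : X → H}
    (hφ : Measurable fun p : X × X => (inner ℝ (φ p.1) (φ p.2) : ℝ)) {A : Type*}
    [MeasurableSpace A] {f g : A → X} (hf : Measurable f) (hg : Measurable g) :
    Measurable fun a => (inner ℝ (φ (f a)) (φ (g a)) : ℝ) :=
  hφ.comp (hf.prodMk hg)

/-- For fixed coefficients the cost depends on the instances only through kernel values; no
measurable structure on `H` is required. -/
theorem measurable_cost_combination {φ : X → H}
    (hφ : Measurable fun p : X × X => (inner ℝ (φ p.1) (φ p.2) : ℝ)) (ρ : ℝ)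
    (I : Finset (Fin N)) (c : (Fin N → ℝ) × ℝ) :
    Measurable fun z : Fin N → X × Label => cost φ ρ (subsample z I) (combination φ z I c) := by
  have hk : ∀ i j, Measurable fun z : Fin N → X × Label =>
      (inner ℝ (φ (z i).1) (φ (z j).1) : ℝ) := fun i j =>
    measurable_kernel_eval hφ (by fun_prop) (by fun_prop)
  have hcost : ∀ z : Fin N → X × Label, cost φ ρ (subsample z I) (combination φ z I c) =
      ∑ j ∈ I, ∑ i ∈ I, c.1 j * (c.1 i * inner ℝ (φ (z i).1) (φ (z j).1)) +
      ρ * ∑ j ∈ I, max 0 (1 - ((z j).2 : ℝ) *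
        (∑ i ∈ I, c.1 i * inner ℝ (φ (z i).1) (φ (z j).1) + c.2)) := by
    intro z
    simp only [← decisionValue_combination]
    unfold cost
    congr 1
    · rw [← real_inner_self_eq_norm_sq]
      simp only [combination, sum_inner, inner_sum, real_inner_smul_left, real_inner_smul_right]
    · simp [loss, subsample, hinge, marginGap]
  simp only [hcost]
  fun_prop

-- The coefficients are the first member of a dense sequence that nearly minimizes the penalized
-- cost over that sequence. A first index defined by measurable conditions is measurable.
open Classical in
theorem exists_measurable_tendsto_solution {φ : X → H}
    (hφ : Measurable fun p : X × X => (inner ℝ (φ p.1) (φ p.2) : ℝ)) {ρ : ℝ} (hρ : 0 < ρ)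
    (I : Finset (Fin N)) :
    ∃ c : ℕ → (Fin N → X × Label) → (Fin N → ℝ) × ℝ, (∀ n, Measurable (c n)) ∧
      ∀ z, Tendsto (fun n => combination φ z I (c n z)) atTop
        (𝓝 (solution φ ρ (subsample z I))) := by
  set ε : ℕ → ℝ := fun n => 1 / ((n : ℝ) + 1) with hεdef
  have hε : ∀ n, 0 < ε n := fun n => by positivity
  set q : ℕ → (Fin N → ℝ) × ℝ := TopologicalSpace.denseSeq _ with hq
  set F : ℕ → (Fin N → X × Label) → (Fin N → ℝ) × ℝ → ℝ := fun n z c =>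
    cost φ ρ (subsample z I) (combination φ z I c) + ε n * c.2 ^ 2 with hF
  have hF0 : ∀ n z c, 0 ≤ F n z c := fun n z c => by
    have h1 := loss_nonneg φ (subsample z I) (combination φ z I c)
    have h2 := (hε n).le
    simp only [hF, cost]
    positivity
  have hex : ∀ n z, ∃ k, ∀ l, F n z (q k) ≤ F n z (q l) + ε n ^ 2 := fun n z => by
    have hbdd : BddBelow (Set.range fun l => F n z (q l)) := ⟨0, by
      rintro _ ⟨l, rfl⟩
      exact hF0 n z _⟩
    have hpos : 0 < ε n ^ 2 := pow_pos (hε n) 2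
    obtain ⟨k, hk⟩ := exists_lt_of_ciInf_lt (lt_add_of_pos_right (⨅ l, F n z (q l)) hpos)
    exact ⟨k, fun l => hk.le.trans (by linarith [ciInf_le hbdd l])⟩
  have hmeas : ∀ n k, MeasurableSet {z | ∀ l, F n z (q k) ≤ F n z (q l) + ε n ^ 2} := by
    intro n k
    have h1 : ∀ k, Measurable fun z => F n z (q k) := fun k =>
      (measurable_cost_combination hφ ρ I (q k)).add_const _
    rw [Set.ofPred_forall]
    exact MeasurableSet.iInter fun l => measurableSet_le (h1 k) ((h1 l).add_const _)
  refine ⟨fun n z => q (Nat.find (hex n z)), fun n =>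
    (measurable_from_nat (f := q)).comp (measurable_find (hex n) (hmeas n)), fun z => ?_⟩
  refine tendsto_solution hρ hε tendsto_one_div_add_atTop_nhds_zero_nat fun n => ?_
  obtain ⟨c, hc⟩ := exists_combination_eq_solution φ hρ z I
  have hcont : Continuous (F n z) :=
    ((continuous_cost φ ρ _).comp (continuous_combination φ z I)).add (by fun_prop)
  -- Near-minimality over the dense sequence extends to all coefficients by continuity, in
  -- particular to those of the exact solution.
  have hle : F n z (q (Nat.find (hex n z))) ≤ F n z c + ε n ^ 2 :=
    (TopologicalSpace.denseRange_denseSeq _).induction_on c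
      (isClosed_le continuous_const (hcont.add continuous_const)) (Nat.find_spec (hex n z))
  rw [← hc]
  exact hle

theorem measurable_decisionValue {φ : X → H}
    (hφ : Measurable fun p : X × X => (inner ℝ (φ p.1) (φ p.2) : ℝ)) {ρ : ℝ} (hρ : 0 < ρ)
    (I : Finset (Fin N)) :
    Measurable fun a : (Fin N → X × Label) × X =>
      decisionValue φ (solution φ ρ (subsample a.1 I)) a.2 := by
  obtain ⟨c, hc, hlim⟩ := exists_measurable_tendsto_solution hφ hρ I
  refine measurable_of_tendsto_metrizable (f := fun n (a : (Fin N → X × Label) × X) =>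
    decisionValue φ (combination φ a.1 I (c n a.1)) a.2) (fun n => ?_) ?_
  · simp only [decisionValue_combination]
    have h1 : Measurable fun a : (Fin N → X × Label) × X => c n a.1 := (hc n).comp measurable_fst
    have h2 : ∀ i, Measurable fun a : (Fin N → X × Label) × X =>
        (inner ℝ (φ (a.1 i).1) (φ a.2) : ℝ) := fun i =>
      measurable_kernel_eval hφ (by fun_prop) (by fun_prop)
    fun_prop
  · refine tendsto_pi_nhds.2 fun a => ?_
    have hcont : Continuous fun p : H × ℝ => decisionValue φ p a.2 := by
      unfold decisionValue
      fun_prop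
    exact (hcont.tendsto _).comp (hlim a.1)

theorem measurable_solution_snd {φ : X → H}
    (hφ : Measurable fun p : X × X => (inner ℝ (φ p.1) (φ p.2) : ℝ)) {ρ : ℝ} (hρ : 0 < ρ)
    (I : Finset (Fin N)) :
    Measurable fun z : Fin N → X × Label => (solution φ ρ (subsample z I)).2 := by
  obtain ⟨c, hc, hlim⟩ := exists_measurable_tendsto_solution hφ hρ I
  exact measurable_of_tendsto_metrizable (fun n => (hc n).snd)
    (tendsto_pi_nhds.2 fun z => (continuous_snd.tendsto _).comp (hlim z))

/-- Only the second factor is approximated. The inner product of the exact first factor with a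
feature vector is a decision value minus the offset, already known to be measurable. -/
theorem measurable_inner_solution {φ : X → H}
    (hφ : Measurable fun p : X × X => (inner ℝ (φ p.1) (φ p.2) : ℝ)) {ρ : ℝ} (hρ : 0 < ρ)
    (I J : Finset (Fin N)) :
    Measurable fun z : Fin N → X × Label =>
      (inner ℝ (solution φ ρ (subsample z I)).1 (solution φ ρ (subsample z J)).1 : ℝ) := by
  obtain ⟨c, hc, hlim⟩ := exists_measurable_tendsto_solution hφ hρ J
  refine measurable_of_tendsto_metrizable (f := fun n (z : Fin N → X × Label) =>
    (inner ℝ (solution φ ρ (subsample z I)).1 (combination φ z J (c n z)).1 : ℝ))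
    (fun n => ?_) ?_
  · have h1 : ∀ i, Measurable fun z : Fin N → X × Label =>
        (inner ℝ (solution φ ρ (subsample z I)).1 (φ (z i).1) : ℝ) := fun i => by
      have h2 : Measurable fun z : Fin N → X × Label =>
          decisionValue φ (solution φ ρ (subsample z I)) (z i).1 :=
        (measurable_decisionValue hφ hρ I).comp
          (measurable_id.prodMk (by fun_prop : Measurable fun z : Fin N → X × Label => (z i).1))
      convert h2.sub (measurable_solution_snd hφ hρ I) using 2
      simp [decisionValue]
    have h3 := hc n
    simp only [combination, inner_sum, real_inner_smul_right]
    fun_prop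
  · refine tendsto_pi_nhds.2 fun z => ?_
    have hcont : Continuous fun p : H × ℝ =>
        (inner ℝ (solution φ ρ (subsample z I)).1 p.1 : ℝ) := by fun_prop
    exact (hcont.tendsto _).comp (hlim z)

/-- Equality of the `w`-components is the vanishing of the squared distance, expanded into inner
products. -/
theorem measurableSet_solution_eq {φ : X → H}
    (hφ : Measurable fun p : X × X => (inner ℝ (φ p.1) (φ p.2) : ℝ)) {ρ : ℝ} (hρ : 0 < ρ)
    (I J : Finset (Fin N)) :
    MeasurableSet {z : Fin N → X × Label |
      solution φ ρ (subsample z I) = solution φ ρ (subsample z J)} := by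
  have h1 : {z : Fin N → X × Label |
      solution φ ρ (subsample z I) = solution φ ρ (subsample z J)} =
      {z | (inner ℝ (solution φ ρ (subsample z I)).1 (solution φ ρ (subsample z I)).1 : ℝ) -
        2 * inner ℝ (solution φ ρ (subsample z I)).1 (solution φ ρ (subsample z J)).1 +
        inner ℝ (solution φ ρ (subsample z J)).1 (solution φ ρ (subsample z J)).1 = 0} ∩
      {z | (solution φ ρ (subsample z I)).2 = (solution φ ρ (subsample z J)).2} := by
    ext z
    simp only [Set.mem_inter_iff, Set.mem_ofPred_eq]
    rw [real_inner_self_eq_norm_sq, real_inner_self_eq_norm_sq, ← norm_sub_sq_real,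
      sq_eq_zero_iff, norm_eq_zero, sub_eq_zero, Prod.ext_iff]
  rw [h1]
  have h2 := fun I J => measurable_inner_solution (N := N) hφ hρ I J
  exact (measurableSet_eq_fun (((h2 I I).sub ((h2 I J).const_mul 2)).add (h2 J J))
    measurable_const).inter (measurableSet_eq_fun (measurable_solution_snd hφ hρ I)
      (measurable_solution_snd hφ hρ J))

theorem measurable_marginGap {φ : X → H}
    (hφ : Measurable fun p : X × X => (inner ℝ (φ p.1) (φ p.2) : ℝ)) {ρ : ℝ} (hρ : 0 < ρ)
    (J : Finset (Fin N)) (i : Fin N) :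
    Measurable fun z : Fin N → X × Label =>
      marginGap φ (solution φ ρ (subsample z J)) (z i) := by
  have h2 : Measurable fun z : Fin N → X × Label =>
      decisionValue φ (solution φ ρ (subsample z J)) (z i).1 :=
    (measurable_decisionValue hφ hρ J).comp
      (measurable_id.prodMk (by fun_prop : Measurable fun z : Fin N → X × Label => (z i).1))
  unfold marginGap
  fun_prop

theorem measurableSet_isCompressionSet {φ : X → H}
    (hφ : Measurable fun p : X × X => (inner ℝ (φ p.1) (φ p.2) : ℝ)) {ρ : ℝ} (hρ : 0 < ρ)
    (J I : Finset (Fin N)) :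
    MeasurableSet {z : Fin N → X × Label | IsCompressionSet φ ρ z J I} := by
  have hrep : ∀ I, MeasurableSet {z : Fin N → X × Label | IsRepresentative φ ρ z J I} := by
    intro I
    have hgap := fun i => measurable_marginGap hφ hρ J i
    have h1 : {z : Fin N → X × Label | IsRepresentative φ ρ z J I} = {z | I ⊆ J ∧
        (∀ i, i ∈ I → 0 ≤ marginGap φ (solution φ ρ (subsample z J)) (z i)) ∧
        (∀ i, i ∈ J → 0 < marginGap φ (solution φ ρ (subsample z J)) (z i) → i ∈ I) ∧
        solution φ ρ (subsample z I) = solution φ ρ (subsample z J)} := by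
      ext z
      exact ⟨fun h => ⟨h.1, h.2, h.3, h.4⟩, fun h => ⟨h.1, h.2.1, h.2.2.1, h.2.2.2⟩⟩
    rw [h1]
    have h2 : ∀ p : Prop, Measurable fun _ : Fin N → X × Label => p := fun p => measurable_const
    refine measurableSet_setOfPred.2 ((h2 _).and (Measurable.and ?_ (Measurable.and ?_
      (measurableSet_setOfPred.1 (measurableSet_solution_eq hφ hρ I J)))))
    · exact Measurable.forall fun i => (h2 _).imp
        (measurableSet_setOfPred.1 (measurableSet_le measurable_const (hgap i)))
    · exact Measurable.forall fun i => (h2 _).imp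
        ((measurableSet_setOfPred.1 (measurableSet_lt measurable_const (hgap i))).imp (h2 _))
  have h1 : {z : Fin N → X × Label | IsCompressionSet φ ρ z J I} = {z |
      IsRepresentative φ ρ z J I ∧
        ∀ I', IsRepresentative φ ρ z J I' → I.card ≤ I'.card} := by
    ext z
    exact ⟨fun h => ⟨h.1, h.2⟩, fun h => ⟨h.1, h.2⟩⟩
  rw [h1]
  exact measurableSet_setOfPred.2 ((measurableSet_setOfPred.1 (hrep I)).and
    (Measurable.forall fun I' => (measurableSet_setOfPred.1 (hrep I')).imp measurable_const))

theorem measurableSet_misclassified {φ : X → H}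
    (hφ : Measurable fun p : X × X => (inner ℝ (φ p.1) (φ p.2) : ℝ)) {ρ : ℝ} (hρ : 0 < ρ)
    (I : Finset (Fin N)) :
    MeasurableSet {a : (Fin N → X × Label) × (X × Label) |
      svm φ ρ (subsample a.1 I) a.2.1 ≠ a.2.2} := by
  have h1 : Measurable fun a : (Fin N → X × Label) × (X × Label) =>
      svm φ ρ (subsample a.1 I) a.2.1 := by
    unfold svm
    refine Measurable.ite (measurableSet_le measurable_const ?_) measurable_const measurable_const
    exact (measurable_decisionValue hφ hρ I).comp
      (by fun_prop : Measurable fun a : (Fin N → X × Label) × (X × Label) => (a.1, a.2.1))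
  exact (measurableSet_eq_fun h1 (by fun_prop)).compl

end Measurability

end SVMRisk

end

noncomputable section

namespace SVMRisk

/-! ### The risk bound for a compression scheme -/

section Scheme

open scoped ENNReal

variable {Z : Type*} [MeasurableSpace Z] {N : ℕ}

/-- Coordinate `j` is integrated out first: neither `G` nor the section of `A` depends on it, so the
indicator averages to the measure of the section. -/
theorem lintegral_mul_indicator_eval (D : Measure Z) [IsProbabilityMeasure D] (j : Fin N)
    {G : (Fin N → Z) → ℝ≥0∞} (hG : Measurable G) (hGj : ∀ z a, G (Function.update z j a) = G z)
    {A : Set ((Fin N → Z) × Z)} (hA : MeasurableSet A)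
    (hAj : ∀ z a b, (Function.update z j a, b) ∈ A ↔ (z, b) ∈ A) :
    ∫⁻ z, G z * A.indicator 1 (z, z j) ∂Measure.pi (fun _ => D) =
      ∫⁻ z, G z * D {a | (z, a) ∈ A} ∂Measure.pi (fun _ => D) := by
  classical
  have hind : Measurable (A.indicator (1 : (Fin N → Z) × Z → ℝ≥0∞)) :=
    measurable_one.indicator hA
  have hQ : Measurable fun z => D {a | (z, a) ∈ A} := measurable_measure_prodMk_left hA
  refine lintegral_eq_of_lmarginal_eq {j} (hG.mul (hind.comp (by fun_prop))) (hG.mul hQ) ?_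
  rw [lmarginal_singleton, lmarginal_singleton]
  funext z
  have h1 : ∀ a, A.indicator (1 : (Fin N → Z) × Z → ℝ≥0∞) (Function.update z j a, a) =
      {a | (z, a) ∈ A}.indicator 1 a := fun a => by
    simp [Set.indicator_apply, hAj]
  have hm : MeasurableSet {a | (z, a) ∈ A} := measurable_prodMk_left hA
  simp only [Function.update_self, hGj, h1, hAj]
  rw [lintegral_const_mul _ (measurable_one.indicator hm), lintegral_indicator_one hm]
  simp

/-- Induction on `T`: each integrated coordinate yields one factor, which is absorbed into `F`
because it is independent of the coordinates still to be treated. -/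
theorem lintegral_mul_prod_indicator_eval (D : Measure Z) [IsProbabilityMeasure D]
    (T : Finset (Fin N)) {A : Set ((Fin N → Z) × Z)} (hA : MeasurableSet A)
    (hAT : ∀ j ∈ T, ∀ z a b, (Function.update z j a, b) ∈ A ↔ (z, b) ∈ A)
    {F : (Fin N → Z) → ℝ≥0∞} (hF : Measurable F)
    (hFT : ∀ j ∈ T, ∀ z a, F (Function.update z j a) = F z) :
    ∫⁻ z, F z * ∏ j ∈ T, A.indicator 1 (z, z j) ∂Measure.pi (fun _ => D) =
      ∫⁻ z, F z * D {a | (z, a) ∈ A} ^ T.card ∂Measure.pi (fun _ => D) := by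
  have hind : Measurable (A.indicator (1 : (Fin N → Z) × Z → ℝ≥0∞)) :=
    measurable_one.indicator hA
  have hQ : Measurable fun z => D {a | (z, a) ∈ A} := measurable_measure_prodMk_left hA
  classical
  induction T using Finset.induction generalizing F with
  | empty => simp
  | insert j T hj ih =>
    have hATj := hAT j (Finset.mem_insert_self j T)
    have hFTj := hFT j (Finset.mem_insert_self j T)
    have hAT' := fun i (hi : i ∈ T) => hAT i (Finset.mem_insert_of_mem hi)
    have hFT' := fun i (hi : i ∈ T) => hFT i (Finset.mem_insert_of_mem hi)
    have hprod : Measurable fun z : Fin N → Z =>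
        ∏ i ∈ T, A.indicator (1 : (Fin N → Z) × Z → ℝ≥0∞) (z, z i) :=
      Finset.measurable_fun_prod _ fun i _ => hind.comp (by fun_prop)
    calc ∫⁻ z, F z * ∏ i ∈ insert j T, A.indicator 1 (z, z i) ∂Measure.pi (fun _ => D)
        = ∫⁻ z, (F z * ∏ i ∈ T, A.indicator 1 (z, z i)) * A.indicator 1 (z, z j)
            ∂Measure.pi (fun _ => D) := by
          refine lintegral_congr fun z => ?_
          rw [Finset.prod_insert hj]
          ring
      _ = ∫⁻ z, (F z * ∏ i ∈ T, A.indicator 1 (z, z i)) * D {a | (z, a) ∈ A}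
            ∂Measure.pi (fun _ => D) := by
          refine lintegral_mul_indicator_eval D j (hF.mul hprod) (fun z a => ?_) hA hATj
          rw [Pi.mul_apply, Pi.mul_apply, hFTj]
          congr 1
          refine Finset.prod_congr rfl fun i hi => ?_
          rw [Function.update_of_ne (ne_of_mem_of_not_mem hi hj)]
          simp [Set.indicator_apply, hATj]
      _ = ∫⁻ z, (F z * D {a | (z, a) ∈ A}) * ∏ i ∈ T, A.indicator 1 (z, z i)
            ∂Measure.pi (fun _ => D) := by
          refine lintegral_congr fun z => ?_
          ring
      _ = ∫⁻ z, (F z * D {a | (z, a) ∈ A}) * D {a | (z, a) ∈ A} ^ T.card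
            ∂Measure.pi (fun _ => D) := by
          refine ih hAT' (hF.mul hQ) fun i hi z a => ?_
          simp only [hFT' i hi, hAT' i hi]
      _ = _ := by
          refine lintegral_congr fun z => ?_
          rw [Finset.card_insert_of_notMem hj]
          ring

/-- A compression scheme for sequences of `N` examples: `compresses J I` is the event that `I` is
one of the compressed sets of indices of the subsequence with indices in `J`, and `correct I` is the
set of the pairs of a sequence and an example that is correctly dealt with by the predictor built
from the subsequence with indices in `I`. -/
structure CompressionScheme (Z : Type*) [MeasurableSpace Z] (N : ℕ) where
  compresses : Finset (Fin N) → Finset (Fin N) → Set (Fin N → Z)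
  correct : Finset (Fin N) → Set ((Fin N → Z) × Z)
  measurableSet_compresses : ∀ J I, MeasurableSet (compresses J I)
  measurableSet_correct : ∀ I, MeasurableSet (correct I)
  exists_compresses : ∀ z J, ∃ I, z ∈ compresses J I
  compresses_of_subset : ∀ {z J I}, z ∈ compresses Finset.univ I → I ⊆ J → z ∈ compresses J I
  compresses_extend : ∀ {z J I I'}, z ∈ compresses Finset.univ I → I ⊆ J → z ∈ compresses J I' →
    z ∈ compresses Finset.univ I'
  compresses_update : ∀ {J I j}, j ∉ J → ∀ z a,
    Function.update z j a ∈ compresses J I ↔ z ∈ compresses J I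
  correct_update : ∀ {I j}, j ∉ I → ∀ z a b,
    (Function.update z j a, b) ∈ correct I ↔ (z, b) ∈ correct I
  correct_of_notMem : ∀ {z I j}, z ∈ compresses Finset.univ I → j ∉ I → (z, z j) ∈ correct I

namespace CompressionScheme

variable (c : CompressionScheme Z N)

/-- The number of compressed sets of the subsequence with indices in `J`. -/
def count (J : Finset (Fin N)) (z : Fin N → Z) : ℝ≥0∞ := ∑ I, (c.compresses J I).indicator 1 z

/-- The unit mass is divided equally among the compressed sets. -/
def weight (J I : Finset (Fin N)) (z : Fin N → Z) : ℝ≥0∞ :=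
  (c.compresses J I).indicator 1 z / c.count J z

/-- The probability of a correct prediction. -/
def accuracy (D : Measure Z) (I : Finset (Fin N)) (z : Fin N → Z) : ℝ≥0∞ :=
  D {a | (z, a) ∈ c.correct I}

theorem measurable_count (J : Finset (Fin N)) : Measurable (c.count J) :=
  Finset.measurable_fun_sum _ fun I _ =>
    measurable_one.indicator (c.measurableSet_compresses J I)

theorem measurable_weight (J I : Finset (Fin N)) : Measurable (c.weight J I) :=
  (measurable_one.indicator (c.measurableSet_compresses J I)).div (c.measurable_count J)

theorem measurable_accuracy (D : Measure Z) [IsProbabilityMeasure D] (I : Finset (Fin N)) :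
    Measurable (c.accuracy D I) :=
  measurable_measure_prodMk_left (c.measurableSet_correct I)

theorem count_ne_zero (J : Finset (Fin N)) (z : Fin N → Z) : c.count J z ≠ 0 := by
  obtain ⟨I, hI⟩ := c.exists_compresses z J
  intro h
  have := Finset.sum_eq_zero_iff.1 h I (Finset.mem_univ I)
  simp [hI] at this

theorem count_ne_top (J : Finset (Fin N)) (z : Fin N → Z) : c.count J z ≠ ∞ := by
  refine ENNReal.sum_ne_top.2 fun I _ => ?_
  by_cases h : z ∈ c.compresses J I <;> simp [h]

theorem sum_weight (J : Finset (Fin N)) (z : Fin N → Z) : ∑ I, c.weight J I z = 1 := by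
  simp only [weight, div_eq_mul_inv]
  rw [← Finset.sum_mul]
  exact ENNReal.mul_inv_cancel (c.count_ne_zero J z) (c.count_ne_top J z)

theorem weight_update {J I : Finset (Fin N)} {j : Fin N} (hj : j ∉ J) (z : Fin N → Z) (a : Z) :
    c.weight J I (Function.update z j a) = c.weight J I z := by
  classical
  simp [weight, count, Set.indicator_apply, c.compresses_update hj]

/-- When `I` compresses the full sample, all indicators equal 1 and `I` also compresses `J`. Each
set compressing `J` compresses the full sample, so the count for `J` is the smaller denominator. -/
theorem weight_univ_le {J I : Finset (Fin N)} (hI : I ⊆ J) (z : Fin N → Z) :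
    c.weight Finset.univ I z ≤
      c.weight J I z * ∏ j ∈ Jᶜ, (c.correct I).indicator 1 (z, z j) := by
  by_cases hz : z ∈ c.compresses Finset.univ I
  · have h1 : ∀ j ∈ Jᶜ, (c.correct I).indicator (1 : (Fin N → Z) × Z → ℝ≥0∞) (z, z j) = 1 := fun j hj =>
      Set.indicator_of_mem
        (c.correct_of_notMem hz fun h => Finset.mem_compl.1 hj (hI h)) _
    rw [Finset.prod_congr rfl h1, Finset.prod_const_one, mul_one, weight, weight,
      Set.indicator_of_mem hz, Set.indicator_of_mem (c.compresses_of_subset hz hI)]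
    refine ENNReal.div_le_div_left (Finset.sum_le_sum fun I' _ => ?_) _
    by_cases hz' : z ∈ c.compresses J I'
    · rw [Set.indicator_of_mem hz', Set.indicator_of_mem (c.compresses_extend hz hI hz')]
    · rw [Set.indicator_of_notMem hz']
      exact zero_le
  · simp [weight, Set.indicator_of_notMem hz]

/-- The examples outside `J` contribute exactly the power of the accuracy that cancels the inverse.
-/
theorem lintegral_weight_mul_inv_le (D : Measure Z) [IsProbabilityMeasure D]
    {J I : Finset (Fin N)} (hI : I ⊆ J) :
    ∫⁻ z, c.weight Finset.univ I z * (c.accuracy D I z ^ (N - J.card))⁻¹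
        ∂Measure.pi (fun _ => D) ≤
      ∫⁻ z, c.weight J I z ∂Measure.pi (fun _ => D) := by
  have hIJ : ∀ j ∈ Jᶜ, j ∉ I := fun j hj h => Finset.mem_compl.1 hj (hI h)
  have hcard : Jᶜ.card = N - J.card := by rw [Finset.card_compl, Fintype.card_fin]
  calc ∫⁻ z, c.weight Finset.univ I z * (c.accuracy D I z ^ (N - J.card))⁻¹
        ∂Measure.pi (fun _ => D)
      ≤ ∫⁻ z, (c.weight J I z * (c.accuracy D I z ^ (N - J.card))⁻¹) *
          ∏ j ∈ Jᶜ, (c.correct I).indicator 1 (z, z j) ∂Measure.pi (fun _ => D) := by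
        refine lintegral_mono fun z => ?_
        rw [mul_right_comm]
        exact mul_le_mul_left (c.weight_univ_le hI z) _
    _ = ∫⁻ z, (c.weight J I z * (c.accuracy D I z ^ (N - J.card))⁻¹) *
          c.accuracy D I z ^ (N - J.card) ∂Measure.pi (fun _ => D) := by
        rw [← hcard]
        refine lintegral_mul_prod_indicator_eval D Jᶜ (c.measurableSet_correct I)
          (fun j hj => c.correct_update (hIJ j hj))
          ((c.measurable_weight J I).mul ((c.measurable_accuracy D I).pow_const _).inv)
          fun j hj z a => ?_
        simp only [c.weight_update (Finset.mem_compl.1 hj), accuracy,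
          c.correct_update (hIJ j hj)]
    _ ≤ ∫⁻ z, c.weight J I z ∂Measure.pi (fun _ => D) := by
        refine lintegral_mono fun z => ?_
        rw [mul_assoc]
        -- Only an inequality holds, since a zero accuracy may give `∞ * 0 = 0`.
        exact mul_le_of_le_one_right' (ENNReal.inv_mul_le_one _)

end CompressionScheme

/-! ### Properties of the bound -/

theorem Psi_le_Psi {δ : ℝ} (hδ : 0 ≤ δ) (N k : ℕ) {a b : ℝ} (hab : a ≤ b) (hb : b < 1) :
    Psi N δ k a ≤ Psi N δ k b := by
  unfold Psi
  have h1b : 0 < 1 - b := by linarith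
  gcongr

theorem epsilonK_spec {N : ℕ} {δ : ℝ} {k : ℕ} (hk : k < N) (h0 : 0 < δ) (h1 : δ < 1) :
    IsPsiRoot N δ k (epsilonK N δ k) := by
  rw [epsilonK, if_pos hk]
  exact Classical.epsilon_spec (existsUnique_isPsiRoot N δ k hk h0 h1).exists

theorem card_supersets_ge {I : Finset (Fin N)} {m : ℕ} (hm : I.card ≤ m) :
    (N - I.card).choose (m - I.card) ≤
      ((Finset.powersetCard m Finset.univ).filter fun J => I ⊆ J).card := by
  have h1 : (Finset.powersetCard (m - I.card) Iᶜ).card = (N - I.card).choose (m - I.card) := by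
    rw [Finset.card_powersetCard, Finset.card_compl, Fintype.card_fin]
  rw [← h1]
  have hdisj : ∀ K ∈ Finset.powersetCard (m - I.card) Iᶜ, Disjoint I K := fun K hK =>
    (disjoint_compl_right (a := I)).mono_right (Finset.mem_powersetCard.1 hK).1
  refine Finset.card_le_card_of_injOn (fun K => I ∪ K) (fun K hK => ?_) fun K hK L hL h => ?_
  · have h2 := (Finset.mem_powersetCard.1 hK).2
    have h3 := Finset.card_union_of_disjoint (hdisj K hK)
    simp only [Finset.coe_filter, Finset.mem_powersetCard, Set.mem_ofPred_eq]
    exact ⟨⟨Finset.subset_univ _, by omega⟩, Finset.subset_union_left⟩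
  · have h2 := hdisj K hK
    have h3 := hdisj L hL
    rw [← Finset.union_sdiff_cancel_left h2, ← Finset.union_sdiff_cancel_left h3]
    exact congrArg (· \ I) h

/-- The coefficient of `Ψ_{k,δ}` in `ℝ≥0∞`. -/
theorem ofReal_coeff_eq {N k m : ℕ} (δ : ℝ) (hδ : 0 ≤ δ) (hkm : k ≤ m) (hmN : m ≤ N) :
    ENNReal.ofReal (δ / N * ((m.choose k : ℝ) / (N.choose k : ℝ))) =
      ENNReal.ofReal (δ / N / (N.choose m : ℝ)) * ((N - k).choose (m - k) : ℕ) := by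
  have h1 : (N.choose m : ℝ) * (m.choose k : ℝ) = N.choose k * (N - k).choose (m - k) := by
    exact_mod_cast Nat.choose_mul hkm
  have h2 : (N.choose m : ℝ) ≠ 0 := by exact_mod_cast (Nat.choose_pos hmN).ne'
  have h3 : (N.choose k : ℝ) ≠ 0 := by exact_mod_cast (Nat.choose_pos (hkm.trans hmN)).ne'
  rw [← ENNReal.ofReal_natCast ((N - k).choose (m - k)), ← ENNReal.ofReal_mul (by positivity)]
  congr 1
  have h4 : (m.choose k : ℝ) / N.choose k = (N - k).choose (m - k) / N.choose m := by
    rw [div_eq_div_iff h3 h2]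
    linear_combination h1
  rw [h4]
  ring

/-- If the risk `1 - q` exceeds `ε_k` then `Ψ_{k,δ}` is at least `1` there. -/
theorem one_le_sum_of_epsilonK_lt {N k : ℕ} {δ : ℝ} (h0 : 0 < δ) (h1 : δ < 1) (hk : k ≤ N)
    {q : ℝ≥0∞} (hq : q ≤ 1) (h : epsilonK N δ k < 1 - q.toReal) :
    1 ≤ ∑ m ∈ Finset.Ico k N,
      ENNReal.ofReal (δ / N * ((m.choose k : ℝ) / (N.choose k : ℝ))) * (q ^ (N - m))⁻¹ := by
  have hkN : k < N := by
    refine lt_of_le_of_ne hk fun hkN => ?_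
    rw [epsilonK, if_neg (by omega)] at h
    linarith [ENNReal.toReal_nonneg (a := q)]
  have hN : (0 : ℝ) < N := by exact_mod_cast (by omega : 0 < N)
  have hqtop : q ≠ ∞ := ne_top_of_le_ne_top ENNReal.one_ne_top hq
  -- At accuracy zero the real inverse would be the default value 0, whereas in `ℝ≥0∞` the summand
  -- `m = N - 1` is infinite.
  rcases eq_or_ne q 0 with rfl | hq0
  · have hlast : N - 1 ∈ Finset.Ico k N := Finset.mem_Ico.2 ⟨by omega, by omega⟩
    refine le_trans ?_ (Finset.single_le_sum (fun _ _ => zero_le) hlast)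
    have h2 : N - (N - 1) = 1 := by omega
    have h3 : (0 : ℝ) < (N - 1).choose k := by exact_mod_cast Nat.choose_pos (by omega)
    have h4 : (0 : ℝ) < N.choose k := by exact_mod_cast Nat.choose_pos (by omega)
    rw [h2, pow_one, ENNReal.inv_zero, ENNReal.mul_top]
    · exact le_top
    · exact (ENNReal.ofReal_pos.2 (by positivity)).ne'
  · have hqpos : 0 < q.toReal := ENNReal.toReal_pos hq0 hqtop
    obtain ⟨-, hroot⟩ := epsilonK_spec hkN h0 h1
    have h2 := Psi_le_Psi h0.le N k h.le (by linarith)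
    rw [hroot] at h2
    rw [← ENNReal.ofReal_one]
    refine (ENNReal.ofReal_le_ofReal h2).trans (le_of_eq ?_)
    rw [Psi, Finset.mul_sum, ENNReal.ofReal_sum_of_nonneg]
    · refine Finset.sum_congr rfl fun m _ => ?_
      rw [sub_sub_cancel, ← mul_assoc, ENNReal.ofReal_mul (by positivity),
        ENNReal.ofReal_inv_of_pos (by positivity), ENNReal.ofReal_pow hqpos.le,
        ENNReal.ofReal_toReal hqtop]
    · intro m _
      rw [sub_sub_cancel]
      positivity

/-! ### Averaging over the subsamples of each size -/

namespace CompressionScheme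

variable (c : CompressionScheme Z N)

/-- The binomial factor counts the `m`-sets containing `I`, so the left side is spread over these
sets and each share is bounded by the weight in `J`. Sets `J` not containing `I` are added
afterwards for free. -/
theorem lintegral_weight_mul_coeff_le (D : Measure Z) [IsProbabilityMeasure D] {δ : ℝ}
    (hδ : 0 ≤ δ) {I : Finset (Fin N)} {m : ℕ} (hIm : I.card ≤ m) (hmN : m ≤ N) :
    ENNReal.ofReal (δ / N * ((m.choose I.card : ℝ) / (N.choose I.card : ℝ))) *
        ∫⁻ z, c.weight Finset.univ I z * (c.accuracy D I z ^ (N - m))⁻¹ ∂Measure.pi (fun _ => D) ≤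
      ENNReal.ofReal (δ / N / (N.choose m : ℝ)) * ∑ J ∈ Finset.powersetCard m Finset.univ,
        ∫⁻ z, c.weight J I z ∂Measure.pi (fun _ => D) := by
  rw [ofReal_coeff_eq δ hδ hIm hmN, mul_assoc]
  refine mul_le_mul_right ?_ _
  refine le_trans ?_ (Finset.sum_le_sum_of_subset
    (Finset.filter_subset (fun J => I ⊆ J) (Finset.powersetCard m Finset.univ)))
  refine le_trans (mul_le_mul_left (Nat.cast_le.2 (card_supersets_ge hIm)) _) ?_
  rw [← nsmul_eq_mul]
  refine Finset.card_nsmul_le_sum _ _ _ fun J hJ => ?_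
  obtain ⟨hJm, hIJ⟩ := Finset.mem_filter.1 hJ
  have := c.lintegral_weight_mul_inv_le D hIJ
  rwa [(Finset.mem_powersetCard.1 hJm).2] at this

theorem measurableSet_epsilonK_lt (D : Measure Z) [IsProbabilityMeasure D] (δ : ℝ) :
    MeasurableSet {z | ∀ I, z ∈ c.compresses Finset.univ I →
      epsilonK N δ I.card < 1 - (c.accuracy D I z).toReal} := by
  refine measurableSet_setOfPred.2 (Measurable.forall fun I => Measurable.imp
    (measurableSet_setOfPred.1 (c.measurableSet_compresses _ I)) (measurableSet_setOfPred.1 ?_))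
  exact measurableSet_lt measurable_const
    (measurable_const.sub (c.measurable_accuracy D I).ennreal_toReal)

/-- The risk bound: for independent examples, the probability that all compressed sets have a risk
that exceeds `ε` at their cardinality is at most `δ`. -/
theorem measure_epsilonK_lt_le (D : Measure Z) [IsProbabilityMeasure D] {δ : ℝ} (h0 : 0 < δ)
    (h1 : δ < 1) :
    Measure.pi (fun _ : Fin N => D) {z | ∀ I, z ∈ c.compresses Finset.univ I →
      epsilonK N δ I.card < 1 - (c.accuracy D I z).toReal} ≤ ENNReal.ofReal δ := by
  set P := Measure.pi fun _ : Fin N => D with hP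
  set B : Set (Fin N → Z) := {z | ∀ I, z ∈ c.compresses Finset.univ I →
      epsilonK N δ I.card < 1 - (c.accuracy D I z).toReal} with hB
  set κ : ℕ → ℕ → ℝ≥0∞ := fun k m =>
    ENNReal.ofReal (δ / N * ((m.choose k : ℝ) / (N.choose k : ℝ))) with hκ
  have hacc : ∀ I m, Measurable fun z => (c.accuracy D I z ^ m)⁻¹ := fun I m =>
    ((c.measurable_accuracy D I).pow_const m).inv
  -- On the bad event the unit mass is distributed over the compressing sets, and each share is
  -- multiplied by a sum that is at least 1.
  have hpt : ∀ z, B.indicator 1 z ≤ ∑ I, ∑ m ∈ Finset.Ico I.card N,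
      κ I.card m * (c.weight Finset.univ I z * (c.accuracy D I z ^ (N - m))⁻¹) := by
    intro z
    by_cases hz : z ∈ B
    · rw [Set.indicator_of_mem hz, Pi.one_apply, ← c.sum_weight Finset.univ z]
      refine Finset.sum_le_sum fun I _ => ?_
      by_cases hI : z ∈ c.compresses Finset.univ I
      · have hcard : I.card ≤ N := by simpa using Finset.card_le_univ I
        have h2 := mul_le_mul_right
          (one_le_sum_of_epsilonK_lt h0 h1 hcard (prob_le_one : c.accuracy D I z ≤ 1) (hz I hI))
          (c.weight Finset.univ I z)
        rw [mul_one, Finset.mul_sum] at h2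
        refine h2.trans (le_of_eq (Finset.sum_congr rfl fun m _ => ?_))
        rw [mul_left_comm]
        rfl
      · simp [weight, Set.indicator_of_notMem hI]
    · rw [Set.indicator_of_notMem hz]
      exact zero_le
  calc P B ≤ ∫⁻ z, B.indicator 1 z ∂P := by
        rw [lintegral_indicator_one (c.measurableSet_epsilonK_lt D δ)]
      _ ≤ ∫⁻ z, ∑ I, ∑ m ∈ Finset.Ico I.card N,
          κ I.card m * (c.weight Finset.univ I z * (c.accuracy D I z ^ (N - m))⁻¹) ∂P :=
        lintegral_mono hpt
      _ = ∑ I, ∑ m ∈ Finset.Ico I.card N, κ I.card m *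
          ∫⁻ z, c.weight Finset.univ I z * (c.accuracy D I z ^ (N - m))⁻¹ ∂P := by
        have hw := c.measurable_weight Finset.univ
        rw [lintegral_finsetSum _ fun I _ => by fun_prop]
        refine Finset.sum_congr rfl fun I _ => ?_
        rw [lintegral_finsetSum _ fun m _ => by fun_prop]
        exact Finset.sum_congr rfl fun m _ => lintegral_const_mul _ ((hw I).mul (hacc I _))
      _ ≤ ∑ I, ∑ m ∈ Finset.Ico I.card N, ENNReal.ofReal (δ / N / (N.choose m : ℝ)) *
          ∑ J ∈ Finset.powersetCard m Finset.univ, ∫⁻ z, c.weight J I z ∂P := by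
        refine Finset.sum_le_sum fun I _ => Finset.sum_le_sum fun m hm => ?_
        obtain ⟨hm1, hm2⟩ := Finset.mem_Ico.1 hm
        exact c.lintegral_weight_mul_coeff_le D h0.le hm1 hm2.le
      -- The range of `m` is enlarged to be independent of `I`, so that the sums can be exchanged
      -- and the weights in each `J` add up to 1.
      _ ≤ ∑ I : Finset (Fin N), ∑ m ∈ Finset.range N, ENNReal.ofReal (δ / N / (N.choose m : ℝ)) *
          ∑ J ∈ Finset.powersetCard m Finset.univ, ∫⁻ z, c.weight J I z ∂P := by
        refine Finset.sum_le_sum fun I _ => Finset.sum_le_sum_of_subset fun m hm => ?_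
        exact Finset.mem_range.2 (Finset.mem_Ico.1 hm).2
      _ = ∑ m ∈ Finset.range N, ENNReal.ofReal (δ / N / (N.choose m : ℝ)) * (N.choose m : ℕ) := by
        rw [Finset.sum_comm]
        refine Finset.sum_congr rfl fun m _ => ?_
        rw [← Finset.mul_sum, Finset.sum_comm]
        congr 1
        have h2 : ∀ J, ∑ I, ∫⁻ z, c.weight J I z ∂P = 1 := fun J => by
          rw [← lintegral_finsetSum _ fun I _ => c.measurable_weight J I]
          simp [c.sum_weight]
        simp [h2]
      _ = ∑ m ∈ Finset.range N, ENNReal.ofReal (δ / N) := by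
        refine Finset.sum_congr rfl fun m hm => ?_
        have h2 : (N.choose m : ℝ) ≠ 0 := by
          exact_mod_cast (Nat.choose_pos (Finset.mem_range.1 hm).le).ne'
        rw [← ENNReal.ofReal_natCast (N.choose m), ← ENNReal.ofReal_mul (by positivity),
          div_mul_cancel₀ _ h2]
      _ ≤ ENNReal.ofReal δ := by
        rw [Finset.sum_const, Finset.card_range, nsmul_eq_mul, ← ENNReal.ofReal_natCast N,
          ← ENNReal.ofReal_mul (by positivity)]
        refine ENNReal.ofReal_le_ofReal ?_
        rcases Nat.eq_zero_or_pos N with rfl | hN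
        · simpa using h0.le
        · have : (N : ℝ) ≠ 0 := by exact_mod_cast hN.ne'
          rw [mul_div_cancel₀ _ this]

end CompressionScheme

end Scheme

end SVMRisk

end

noncomputable section

namespace SVMRisk

/-! ### The compression scheme of the support vector machine -/

section Main

variable {X : Type*} [MeasurableSpace X] {H : Type*} [NormedAddCommGroup H]
  [InnerProductSpace ℝ H]

/-- The compression scheme of the support vector machine. -/
def svmScheme (φ : X → H) (hφ : Measurable fun p : X × X => (inner ℝ (φ p.1) (φ p.2) : ℝ))
    {ρ : ℝ} (hρ : 0 < ρ) (N : ℕ) : CompressionScheme (X × Label) N where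
  compresses J I := {z | IsCompressionSet φ ρ z J I}
  correct I := {a | svm φ ρ (subsample a.1 I) a.2.1 ≠ a.2.2}ᶜ
  measurableSet_compresses := measurableSet_isCompressionSet hφ hρ
  measurableSet_correct I := (measurableSet_misclassified hφ hρ I).compl
  exists_compresses z J := exists_isCompressionSet φ hρ z J
  compresses_of_subset h hI := h.of_subset hρ hI (Finset.subset_univ _)
  compresses_extend h hI h' := h.extend hρ hI (Finset.subset_univ _) h'
  compresses_update := by
    have key : ∀ {J I : Finset (Fin N)} {j}, j ∉ J → ∀ z (a : X × Label),
        IsRepresentative φ ρ z J I → IsRepresentative φ ρ (Function.update z j a) J I := by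
      intro J I j hj z a h
      have hne : ∀ i ∈ J, Function.update z j a i = z i := fun i hi =>
        Function.update_of_ne (ne_of_mem_of_not_mem hi hj) _ _
      have hI : j ∉ I := fun hjI => hj (h.subset hjI)
      refine ⟨h.subset, fun i hi => ?_, fun i hi => ?_, ?_⟩
      · rw [subsample_update hj, hne i (h.subset hi)]
        exact h.nonneg i hi
      · rw [subsample_update hj, hne i hi]
        exact h.mem_of_pos i hi
      · rw [subsample_update hj, subsample_update hI]
        exact h.solution_eq
    have key' : ∀ {J I : Finset (Fin N)} {j}, j ∉ J → ∀ z (a : X × Label),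
        IsRepresentative φ ρ (Function.update z j a) J I ↔ IsRepresentative φ ρ z J I :=
      fun {_ _ j} hj z a => ⟨fun h => by simpa using key hj _ (z j) h, key hj z a⟩
    intro J I j hj z a
    exact ⟨fun h => ⟨(key' hj z a).1 h.1, fun I' h' => h.2 I' ((key' hj z a).2 h')⟩,
      fun h => ⟨(key' hj z a).2 h.1, fun I' h' => h.2 I' ((key' hj z a).1 h')⟩⟩
  correct_update hj z a b := by
    simp only [Set.mem_compl_iff, Set.mem_ofPred_eq, subsample_update hj]
  correct_of_notMem h hj := fun h' => h' (h.svm_eq (Finset.mem_univ _) hj)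

theorem risk_eq_one_sub_accuracy (φ : X → H)
    (hφ : Measurable fun p : X × X => (inner ℝ (φ p.1) (φ p.2) : ℝ)) {ρ : ℝ} (hρ : 0 < ρ)
    {N : ℕ} (D : Measure (X × Label)) [IsProbabilityMeasure D] (I : Finset (Fin N))
    (z : Fin N → X × Label) :
    risk D (svm φ ρ (subsample z I)) =
      1 - ((svmScheme φ hφ hρ N).accuracy D I z).toReal := by
  have hm : MeasurableSet {a : X × Label | svm φ ρ (subsample z I) a.1 ≠ a.2} :=
    measurable_prodMk_left (measurableSet_misclassified hφ hρ I)
  have h := probReal_compl_eq_one_sub (μ := D) hm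
  show D.real _ = 1 - D.real {a : X × Label | svm φ ρ (subsample z I) a.1 ≠ a.2}ᶜ
  rw [h, sub_sub_cancel]

end Main

end SVMRisk

end

theorem mainTheorem8 {X : Type*} [MeasurableSpace X] [LinearOrder X]
    {H : Type*} [NormedAddCommGroup H] [InnerProductSpace ℝ H] [CompleteSpace H]
    (φ : X → H)
    (hφ : Measurable (fun p : X × X => (inner ℝ (φ p.1) (φ p.2) : ℝ)))
    (ρ : ℝ) (hρ : 0 < ρ)
    (D : Measure (X × SVMRisk.Label)) [IsProbabilityMeasure D]
    {Ω : Type*} [MeasurableSpace Ω] (μ : Measure Ω) [IsProbabilityMeasure μ]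
    (N : ℕ) (Z : Fin N → Ω → X × SVMRisk.Label)
    (hZ : ∀ i, Measurable (Z i)) (hlaw : ∀ i, μ.map (Z i) = D) (hindep : iIndepFun Z μ)
    (δ : ℝ) (hδ0 : 0 < δ) (hδ1 : δ < 1) :
    μ.real {ω |
      SVMRisk.epsilonK N δ
          (SVMRisk.compression φ ρ (SVMRisk.trainingSet fun i => Z i ω)).card
        < SVMRisk.risk D (SVMRisk.svm φ ρ (SVMRisk.trainingSet fun i => Z i ω))} ≤ δ := by
  set c := SVMRisk.svmScheme φ hφ hρ N
  have hmap : μ.map (fun ω i => Z i ω) = Measure.pi fun _ => D := by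
    rw [(iIndepFun_iff_map_fun_eq_pi_map fun i => (hZ i).aemeasurable).1 hindep]
    simp only [hlaw]
  have hbound := c.measure_epsilonK_lt_le D hδ0 hδ1
  rw [← hmap, Measure.map_apply (measurable_pi_lambda _ hZ) (c.measurableSet_epsilonK_lt D δ)]
    at hbound
  -- Monotonicity of the measure suffices: the event of the theorem is only included in a measurable
  -- one, because every compression set has the same cardinality and classifier as the actual
  -- compression and the full sample.
  refine ENNReal.toReal_le_of_le_ofReal hδ0.le (le_trans (measure_mono fun ω hω => ?_) hbound)
  intro I (hI : SVMRisk.IsCompressionSet φ ρ (fun i => Z i ω) Finset.univ I)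
  rw [← SVMRisk.risk_eq_one_sub_accuracy, hI.svm_subsample_eq, ← hI.card_compression]
  exact hω
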